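/- **Setting.** A multi-environment Markov decision process (MEMDP) $\Gamma=(Q,A,E,(\delta_e)_{e\in E})$ consists of non-empty finite sets $Q$ (states), $A$ (actions), $E$ (environments) and, for every $e\in E$, a transition function $\delta_e\colon Q\times A\to\mathcal D(Q)$, where $\mathcal D(X)$ is the set of probability distributions on $X$; $\Gamma[e]$ is the MDP $(Q,A,\delta_e)$. A strategy maps finite runs $q_0a_1q_1\cdots a_nq_n$ to $\mathcal D(A)$. For a strategy $\sigma$ and a state $q$, $\mathbb P^\sigma_q[\Gamma[e],\cdot]$ is the induced probability measure on infinite runs from $q$. A labelling $c\colon Q\to\mathbb N$ defines the parity objective $W\subseteq Q^\omega$ of all paths whose highest label seen infinitely often is even. The value of a state $q$ of an MDP $\mathsf G$ is $\mathrm{val}_q(\mathsf G,W)=\sup_\sigma\mathbb P^\sigma_q[\mathsf G,W]$, and for a belief $b\in\mathcal D(E)$ the prior value is $\mathrm{val}^{\mathrm{pr}}_q(\Gamma,b,W)=\sup_\sigma\sum_{e\in E}b(e)\,\mathbb P^\sigma_q[\Gamma[e],W]$. **Belief updates.** Let $p[b,q,a](q')=\sum_e b(e)\delta_e(q,a)(q')$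 and, if this is positive, $\lambda[b,q,a,q'](e)=b(e)\delta_e(q,a)(q')/p[b,q,a](q')$. If $|\mathrm{Supp}(b)|\ge2$, $\mathrm{Truncate}(b)$ is obtained from $b$ by choosing $e\in\mathrm{Supp}(b)$ with $b(e)$ minimal on $\mathrm{Supp}(b)$ and some $e'\in\mathrm{Supp}(b)\setminus\{e\}$, and moving the mass of $e$ to $e'$. Let $\mathrm{Dstg}_b(\Gamma)$ be the set of all $(q,a)$ with $\delta_e(q,a)\ne\delta_{e'}(q,a)$ for some $e,e'\in\mathrm{Supp}(b)$. **The bound $m$.** Let $\log=\log_2$, let $p_{\min}$ be the smallest positive value $\delta_e(q,a)(q')$, let $R$ be the set of all quotients $\delta_e(q,a)(q')/\delta_{e'}(q,a)(q')$ with both terms positive, $r_{\max}=\max R$, $r_{\min}=\min R$, and $r^{>1}=\min\{r\in R: r>1\}$ ($r^{>1}=1$ if there is no such $r$). Let $\iota=\min((\sqrt{r^{>1}}-1)^2,1)$, $\eta=\log(1-p_{\min}\iota)$, $$n_1=\max\Big(1,\Big\lceil\tfrac{\log(\varepsilon/(2|E|))}{\log(1-p_{\min})}\Big\rceil\Big),\qquad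 n_2=\big\lceil 2|\log\varepsilon|+n_1\log r_{\max}\big\rceil,$$ ($n_1=1$ if $p_{\min}=1$), $n_3=0$ if $\eta=0$ and otherwise $$n_3=\Big\lceil\frac{2\,|\log(\varepsilon/(2|E|))|\,\log(r_{\max}/r_{\min})^2}{\eta^2}+\frac{2n_2}{|\eta|}\Big\rceil ,$$ and $m(\Gamma,\varepsilon)=|E|\,(n_1+n_3)$. **The algorithm** $\textsf{MEMDP-Prior-Parity}(\Gamma,W,b,n,\gamma)$, for $n\in\mathbb N$ and $\gamma>0$. Write $m=m(\Gamma,\frac{\gamma}{3|E|})$. 1. If $\mathrm{Supp}(b)=\{e\}$, return $q\mapsto\mathrm{val}_q(\Gamma[e],W)$. 2. Otherwise, if $n=0$ or $\min_{e\in\mathrm{Supp}(b)}b(e)\le\frac{\gamma}{3|E|}$, return $\textsf{MEMDP-Prior-Parity}(\Gamma,W,\mathrm{Truncate}(b),m,\gamma)$. 3. Otherwise, for all $(q,a)\in\mathrm{Dstg}_b(\Gamma)$ and $q'\in\mathrm{Supp}(p[b,q,a])$, let $b'=\lambda[b,q,a,q']$, let $n'=m$ if $\mathrm{Supp}(b')\subsetneq\mathrm{Supp}(b)$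 and $n'=n-1$ otherwise, and let $v_{q,a,q'}$ be $\textsf{MEMDP-Prior-Parity}(\Gamma,W,b',n',\gamma)(q')$ truncated to $\lceil|\log(\frac{\gamma}{3|E|}\cdot\frac1m)|\rceil$ binary digits after the point. 4. Build the MDP $\mathsf G$ on $Q\cup\{q_{\mathrm{win}},q_{\mathrm{lose}}\}$ in which $q_{\mathrm{win}}$ and $q_{\mathrm{lose}}$ are sinks with labels $0$ and $1$, each $q\in Q$ has label $c(q)$, a pair $(q,a)\notin\mathrm{Dstg}_b(\Gamma)$ keeps the distribution $\delta_e(q,a)$ (the same for all $e\in\mathrm{Supp}(b)$), and a pair $(q,a)\in\mathrm{Dstg}_b(\Gamma)$ leads to $q_{\mathrm{win}}$ with probability $w=\sum_{q'\in\mathrm{Supp}(p[b,q,a])}\sum_{e}b(e)\delta_e(q,a)(q')v_{q,a,q'}$ and to $q_{\mathrm{lose}}$ with probability $1-w$. With $W'$ the parity objective of these labels, return $Q\ni q\mapsto\mathrm{val}_q(\mathsf G,W')$. (The values of MDPs with parity objectives in steps 1 and 4 are computed exactly, by a subroutine.) **Theorem.** For every MEMDP $\Gamma$, parity objective $W$,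 belief $b\in\mathcal D(E)$ and $\varepsilon>0$, the algorithm $\textsf{MEMDP-Prior-Parity}$ executed on $\Gamma$, $W$, $b$ with $n:=m(\Gamma,\frac{\varepsilon}{3|E|})$ and $\gamma:=\varepsilon$ terminates and outputs $f\colon Q\to[0,1]$ such that $|\mathrm{val}^{\mathrm{pr}}_q(\Gamma,b,W)-f(q)|\le\varepsilon$ for all $q\in Q$. -/

import Mathlib

open MeasureTheory ProbabilityTheory Set
open scoped ENNReal

noncomputable section

/-! ### Markov decision processes, strategies, run measures -/

/-- A Markov decision process on the states `Q` and the actions `A`. -/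
structure MDP (Q A : Type*) where
  /-- the transition function -/
  δ : Q → A → PMF Q

/-- A strategy maps every finite run `q₀ a₁ q₁ ⋯ aₙ qₙ` to a distribution over actions. The run is
given as the list `[(q₀, a₁), (q₁, a₂), …, (qₙ₋₁, aₙ)]` together with its head `qₙ`. -/
abbrev Strat (Q A : Type*) := List (Q × A) → Q → PMF A

section RunMeasure

variable {Q A : Type*} [Fintype Q] [Fintype A]
  [MeasurableSpace Q] [MeasurableSingletonClass Q] [MeasurableSpace A] [MeasurableSingletonClass A]

/-- The transition kernel of an infinite run, seen as a sequence of state-action pairs: given the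
pairs number `0, …, n`, the next state is drawn from the MDP and the next action from the
strategy. -/
def MDP.stepKernel (G : MDP Q A) (σ : Strat Q A) (n : ℕ) :
    Kernel ((_ : Finset.Iic n) → Q × A) (Q × A) :=
  Kernel.ofFunOfCountable fun h =>
    ((G.δ (h ⟨n, Finset.mem_Iic.2 le_rfl⟩).1 (h ⟨n, Finset.mem_Iic.2 le_rfl⟩).2).bind fun q' =>
      (σ (List.ofFn fun i : Fin (n + 1) => h ⟨i, Finset.mem_Iic.2 (Nat.lt_succ_iff.1 i.2)⟩) q').map
        fun a => (q', a)).toMeasure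

instance (G : MDP Q A) (σ : Strat Q A) (n : ℕ) : IsMarkovKernel (G.stepKernel σ n) :=
  ⟨fun _ => PMF.toMeasure.isProbabilityMeasure _⟩

/-- The probability measure on infinite runs `(q₀, a₁) (q₁, a₂) ⋯` that the strategy `σ` induces
in the MDP `G` from the state `q`. -/
def MDP.runMeasure (G : MDP Q A) (σ : Strat Q A) (q : Q) : Measure (ℕ → Q × A) :=
  Kernel.trajMeasure (X := fun _ => Q × A) ((σ [] q).map fun a => (q, a)).toMeasure
    (G.stepKernel σ)

instance (G : MDP Q A) (σ : Strat Q A) (q : Q) : IsProbabilityMeasure (G.runMeasure σ q) := by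
  have : IsProbabilityMeasure ((σ [] q).map fun a => (q, a)).toMeasure :=
    PMF.toMeasure.isProbabilityMeasure _
  unfold MDP.runMeasure
  infer_instance

/-- The probability of an objective `W ⊆ Q^ω`, by projection of runs to paths. -/
def MDP.prob (G : MDP Q A) (σ : Strat Q A) (q : Q) (W : Set (ℕ → Q)) : ℝ≥0∞ :=
  G.runMeasure σ q {ω | (fun i => (ω i).1) ∈ W}

theorem MDP.prob_le_one (G : MDP Q A) (σ : Strat Q A) (q : Q) (W : Set (ℕ → Q)) :
    G.prob σ q W ≤ 1 := MeasureTheory.prob_le_one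

/-- The value of a state in an MDP. -/
def MDP.value (G : MDP Q A) (q : Q) (W : Set (ℕ → Q)) : ℝ≥0∞ :=
  ⨆ σ : Strat Q A, G.prob σ q W

theorem MDP.value_le_one (G : MDP Q A) (q : Q) (W : Set (ℕ → Q)) : G.value q W ≤ 1 :=
  iSup_le fun σ => G.prob_le_one σ q W

end RunMeasure

/-- The parity objective of a labelling `c`: the highest label seen infinitely often is even. -/
def parityObjective {Q : Type*} (c : Q → ℕ) : Set (ℕ → Q) :=
  {ρ | Even (sSup {n : ℕ | ∀ i, ∃ j ≥ i, c (ρ j) = n})}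

/-- The subroutine `MDP-Parity`: it returns the exact value of every state of an MDP with a parity
objective. -/
def mdpParity {Q A : Type*} [Fintype Q] [Fintype A] [MeasurableSpace Q]
    [MeasurableSingletonClass Q] [MeasurableSpace A] [MeasurableSingletonClass A]
    (G : MDP Q A) (c : Q → ℕ) (q : Q) : unitInterval :=
  ⟨(G.value q (parityObjective c)).toReal, ENNReal.toReal_nonneg,
    ENNReal.toReal_le_of_le_ofReal zero_le_one (by simpa using G.value_le_one q _)⟩

/-! ### Multi-environment MDPs -/

/-- A multi-environment MDP: one MDP `env e` on the same states and actions for each `e`. -/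
structure MEMDP (Q A E : Type*) where
  /-- the MDP of an environment -/
  env : E → MDP Q A

namespace MEMDP

variable {Q A E : Type*}

/-- The state-action pairs that distinguish two environments of the set `S`. -/
def dstg (Γ : MEMDP Q A E) (S : Set E) : Set (Q × A) :=
  {x | ∃ e ∈ S, ∃ e' ∈ S, (Γ.env e).δ x.1 x.2 ≠ (Γ.env e').δ x.1 x.2}

/-- The distribution `p[b,q,a]` of the next state under the belief `b`, that is
`p[b,q,a](q') = ∑ e, b(e) · δ_e(q,a)(q')`. -/
def next (Γ : MEMDP Q A E) (b : PMF E) (q : Q) (a : A) : PMF Q :=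
  b.bind fun e => (Γ.env e).δ q a

theorem next_apply (Γ : MEMDP Q A E) (b : PMF E) (q : Q) (a : A) (q' : Q) :
    Γ.next b q a q' = ∑' e, b e * (Γ.env e).δ q a q' := rfl

open scoped Classical in
/-- The belief update `λ[b,q,a,q']`, that is
`λ[b,q,a,q'](e) = b(e) · δ_e(q,a)(q') / p[b,q,a](q')` if `p[b,q,a](q') > 0` (and an irrelevant
distribution otherwise). -/
def update (Γ : MEMDP Q A E) (b : PMF E) (q : Q) (a : A) (q' : Q) : PMF E :=
  if h : Γ.next b q a q' ≠ 0 then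
    PMF.normalize (fun e => b e * (Γ.env e).δ q a q') (by rwa [next_apply] at h)
      (by rw [← next_apply]; exact (Γ.next b q a).apply_ne_top q')
  else b

theorem update_apply (Γ : MEMDP Q A E) (b : PMF E) (q : Q) (a : A) (q' : Q)
    (h : Γ.next b q a q' ≠ 0) (e : E) :
    Γ.update b q a q' e = b e * (Γ.env e).δ q a q' / Γ.next b q a q' := by
  rw [update, dif_pos h, PMF.normalize_apply, next_apply, ENNReal.div_eq_inv_mul, mul_comm]

theorem support_update_subset (Γ : MEMDP Q A E) (b : PMF E) (q : Q) (a : A) (q' : Q) :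
    (Γ.update b q a q').support ⊆ b.support := by
  intro e he
  rw [PMF.mem_support_iff] at he ⊢
  intro h0
  by_cases h : Γ.next b q a q' = 0
  · exact he (by rw [update, dif_neg (not_not.2 h), h0])
  · exact he (by rw [update_apply _ _ _ _ _ h, h0]; simp)

section Value

variable [Fintype Q] [Fintype A] [Fintype E]
  [MeasurableSpace Q] [MeasurableSingletonClass Q] [MeasurableSpace A] [MeasurableSingletonClass A]

/-- The prior value: the supremum over all strategies of the average over the environments,
weighted by the prior belief, of the probability of the objective. -/
def priorValue (Γ : MEMDP Q A E) (b : PMF E) (q : Q) (W : Set (ℕ → Q)) : ℝ≥0∞ :=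
  ⨆ σ : Strat Q A, ∑ e, b e * (Γ.env e).prob σ q W

end Value

/-! ### The bound `m(Γ, ε)` -/

/-- The smallest positive transition probability. -/
def pMin (Γ : MEMDP Q A E) : ℝ :=
  sInf {x | ∃ e q a q', x = ((Γ.env e).δ q a q').toReal ∧ 0 < x}

/-- The quotients of two positive probabilities of the same transition. -/
def ratios (Γ : MEMDP Q A E) : Set ℝ :=
  {x | ∃ e e' q a q', 0 < ((Γ.env e).δ q a q').toReal ∧ 0 < ((Γ.env e').δ q a q').toReal ∧
    x = ((Γ.env e).δ q a q').toReal / ((Γ.env e').δ q a q').toReal}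

/-- The largest ratio. -/
def ratioMax (Γ : MEMDP Q A E) : ℝ := sSup Γ.ratios

/-- The smallest (positive) ratio. -/
def ratioMin (Γ : MEMDP Q A E) : ℝ := sInf Γ.ratios

open scoped Classical in
/-- The smallest ratio above `1`, or `1` if there is none. -/
def ratioGtOne (Γ : MEMDP Q A E) : ℝ :=
  if {x ∈ Γ.ratios | 1 < x}.Nonempty then sInf {x ∈ Γ.ratios | 1 < x} else 1

/-- The quantity `ι(Γ)`. -/
def iota (Γ : MEMDP Q A E) : ℝ := min ((√Γ.ratioGtOne - 1) ^ 2) 1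

/-- The quantity `η(Γ)`. -/
def eta (Γ : MEMDP Q A E) : ℝ := Real.logb 2 (1 - Γ.pMin * Γ.iota)

variable [Fintype E]

/-- The quantity `n₁(Γ, ε)`; it is at least `1`, which matters only if all transitions are
deterministic. -/
def n₁ (Γ : MEMDP Q A E) (ε : ℝ) : ℕ :=
  max 1 ⌈Real.logb 2 (ε / (2 * Fintype.card E)) / Real.logb 2 (1 - Γ.pMin)⌉₊

/-- The quantity `n₂(Γ, ε)`. -/
def n₂ (Γ : MEMDP Q A E) (ε : ℝ) : ℕ :=
  ⌈2 * |Real.logb 2 ε| + Γ.n₁ ε * Real.logb 2 Γ.ratioMax⌉₊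

open scoped Classical in
/-- The quantity `n₃(Γ, ε)`. -/
def n₃ (Γ : MEMDP Q A E) (ε : ℝ) : ℕ :=
  if Γ.eta = 0 then 0 else
    ⌈2 * |Real.logb 2 (ε / (2 * Fintype.card E))| *
        Real.logb 2 (Γ.ratioMax / Γ.ratioMin) ^ 2 / Γ.eta ^ 2 +
      2 * Γ.n₂ ε / |Γ.eta|⌉₊

/-- The number `m(Γ, ε)` of distinguishing state-action pairs to visit. -/
def bound (Γ : MEMDP Q A E) (ε : ℝ) : ℕ := Fintype.card E * (Γ.n₁ ε + Γ.n₃ ε)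

end MEMDP

/-! ### Truncation of beliefs -/

section Truncate

variable {E : Type*}

/-- `x` is a pair of distinct environments in the support of `b`, the first of which is a least
likely one. -/
def IsTruncationPair (b : PMF E) (x : E × E) : Prop :=
  x.1 ∈ b.support ∧ x.2 ∈ b.support ∧ x.2 ≠ x.1 ∧ ∀ e ∈ b.support, b x.1 ≤ b e

open scoped Classical in
/-- `Truncate(b)`: choose a least likely environment `e` in the support of `b` and another
environment `e'` in the support, and move the mass of `e` to `e'`. -/
def truncate (b : PMF E) : PMF E :=
  if h : ∃ x : E × E, IsTruncationPair b x then
    b.map fun e => if e = h.choose.1 then h.choose.2 else e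
  else b

theorem exists_isTruncationPair [Finite E] (b : PMF E) (h : b.support.ncard ≠ 1) :
    ∃ x : E × E, IsTruncationPair b x := by
  obtain ⟨e, he, hmin⟩ := b.support.toFinite.exists_minimalFor b _ b.support_nonempty
  have : ∃ e' ∈ b.support, e' ≠ e := by
    by_contra! hc
    exact h (ncard_eq_one.2 ⟨e, eq_singleton_iff_unique_mem.2 ⟨he, hc⟩⟩)
  obtain ⟨e', he', hne⟩ := this
  exact ⟨(e, e'), he, he', hne, fun x hx => (le_total (b e) (b x)).elim id (hmin hx)⟩

theorem support_truncate_ssubset [Finite E] (b : PMF E) (h : b.support.ncard ≠ 1) :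
    (truncate b).support ⊂ b.support := by
  classical
  have hx := exists_isTruncationPair b h
  rw [truncate, dif_pos hx, PMF.support_map]
  obtain ⟨h1, h2, h3, -⟩ := hx.choose_spec
  refine (ssubset_iff_of_subset ?_).2 ⟨hx.choose.1, h1, ?_⟩
  · rintro _ ⟨e, he, rfl⟩
    dsimp only
    split_ifs with hh
    · exact h2
    · exact he
  · rintro ⟨e, he, hh⟩
    dsimp only at hh
    split_ifs at hh with h4
    · exact h3 hh
    · exact h4 hh

end Truncate

/-! ### The MDP built from an MEMDP -/

section MDPFromMEMDP

variable {Q A E : Type*}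

/-- The probability `w_{v,b}(q,a) = ∑ q' ∈ Supp(p[b,q,a]), ∑ e, b(e) · δ_e(q,a)(q') · v(q,a,q')` of
moving to the winning sink. -/
def MEMDP.winProb (Γ : MEMDP Q A E) (b : PMF E) (v : Q → A → Q → unitInterval) (q : Q) (a : A) :
    ℝ≥0∞ :=
  ∑' q' : (Γ.next b q a).support, ∑' e, b e * (Γ.env e).δ q a q' * ENNReal.ofReal (v q a q')

theorem MEMDP.winProb_le_one (Γ : MEMDP Q A E) (b : PMF E) (v : Q → A → Q → unitInterval) (q : Q)
    (a : A) : Γ.winProb b v q a ≤ 1 := by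
  calc Γ.winProb b v q a
      ≤ ∑' q' : (Γ.next b q a).support, Γ.next b q a q' := by
        refine ENNReal.tsum_le_tsum fun q' => ?_
        rw [MEMDP.next_apply]
        refine ENNReal.tsum_le_tsum fun e => ?_
        calc b e * (Γ.env e).δ q a q' * ENNReal.ofReal (v q a q')
            ≤ b e * (Γ.env e).δ q a q' * 1 := by
              gcongr
              exact ENNReal.ofReal_le_one.2 (v q a q').2.2
          _ = _ := mul_one _
    _ ≤ ∑' q', Γ.next b q a q' := ENNReal.tsum_comp_le_tsum_of_injective Subtype.val_injective _
    _ = 1 := (Γ.next b q a).tsum_coe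

/-- The distribution on `Q ∪ {q_win, q_lose}` with mass `w` on `q_win` and `1 - w` on `q_lose`. The
states `q_win` and `q_lose` are `Sum.inr true` and `Sum.inr false`. -/
def sinkPMF (Q : Type*) (w : ℝ≥0∞) (hw : w ≤ 1) : PMF (Q ⊕ Bool) :=
  (PMF.ofFintype (fun s : Bool => if s then w else 1 - w)
    (by simp [add_tsub_cancel_of_le hw])).map Sum.inr

open scoped Classical in
/-- The MDP of `MDP-from-MEMDP(Γ, W, b, v)`, on the states `Q ∪ {q_win, q_lose}`. A state-action pair
that distinguishes no two environments in the support of `b` keeps its distribution, which is the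
same for all environments in the support; all other pairs lead to the two sinks. -/
def mdpFromMEMDP (Γ : MEMDP Q A E) (b : PMF E) (v : Q → A → Q → unitInterval) :
    MDP (Q ⊕ Bool) A where
  δ s a := match s with
    | Sum.inl q =>
      if (q, a) ∈ Γ.dstg b.support then
        sinkPMF Q (Γ.winProb b v q a) (Γ.winProb_le_one b v q a)
      else ((Γ.env b.support_nonempty.some).δ q a).map Sum.inl
    | Sum.inr s => PMF.pure (Sum.inr s)

/-- The labelling of the parity objective of `MDP-from-MEMDP(Γ, W, b, v)`. -/
def sinkLabel (c : Q → ℕ) : Q ⊕ Bool → ℕ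
  | Sum.inl q => c q
  | Sum.inr true => 0
  | Sum.inr false => 1

instance instMeasurableSingletonClassSum {α β : Type*} [MeasurableSpace α] [MeasurableSpace β]
    [MeasurableSingletonClass α] [MeasurableSingletonClass β] :
    MeasurableSingletonClass (α ⊕ β) where
  measurableSet_singleton
    | Sum.inl a => by
      rw [← image_singleton]; exact (measurableSet_singleton a).inl_image
    | Sum.inr a => by
      rw [← image_singleton]; exact (measurableSet_singleton a).inr_image

end MDPFromMEMDP

/-! ### The algorithm -/

/-- The number in `[0,1]` truncated to `k` binary digits after the point. -/
def truncBits (k : ℕ) (x : unitInterval) : unitInterval :=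
  ⟨⌊(2 : ℝ) ^ k * x⌋₊ / 2 ^ k, by positivity, by
    rw [div_le_one (by positivity)]
    refine (Nat.floor_le (mul_nonneg (by positivity) x.2.1)).trans ?_
    exact mul_le_of_le_one_right (by positivity) x.2.2⟩

section Algorithm

variable {Q A E : Type*} [Fintype Q] [Fintype A] [Fintype E]
  [MeasurableSpace Q] [MeasurableSingletonClass Q] [MeasurableSpace A] [MeasurableSingletonClass A]

open scoped Classical in
/-- The algorithm `MEMDP-Prior-Parity(Γ, W, b, n, γ)`, where `W` is the parity objective of the
labelling `c`, with a truncation of the recursively computed values to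
`⌈|log₂ (γ / (3|E|) · 1 / m(Γ, γ / (3|E|)))|⌉` binary digits. -/
def priorParity (Γ : MEMDP Q A E) (c : Q → ℕ) (γ : ℝ) (b : PMF E) (n : ℕ) : Q → unitInterval :=
  if b.support.ncard = 1 then
    mdpParity (Γ.env b.support_nonempty.some) c
  else if n = 0 ∨ ∃ e ∈ b.support, (b e).toReal ≤ γ / (3 * Fintype.card E) then
    priorParity Γ c γ (truncate b) (Γ.bound (γ / (3 * Fintype.card E)))
  else
    let v : Q → A → Q → unitInterval := fun q a q' =>
      if (q, a) ∈ Γ.dstg b.support ∧ q' ∈ (Γ.next b q a).support then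
        truncBits
          ⌈|Real.logb 2 (γ / (3 * Fintype.card E) * (1 / Γ.bound (γ / (3 * Fintype.card E))))|⌉₊
          (priorParity Γ c γ (Γ.update b q a q')
            (if (Γ.update b q a q').support ⊂ b.support then
              Γ.bound (γ / (3 * Fintype.card E)) else n - 1) q')
      else 0
    fun q => mdpParity (mdpFromMEMDP Γ b v) (sinkLabel c) (Sum.inl q)
termination_by (b.support.ncard, n)
decreasing_by
  · exact Prod.Lex.left _ _ (ncard_lt_ncard (support_truncate_ssubset b ‹_›))
  · rename_i h1 h2 _
    split_ifs with hs
    · exact Prod.Lex.left _ _ (ncard_lt_ncard hs)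
    · have hn : n ≠ 0 := fun h => h2 (Or.inl h)
      rw [((Γ.support_update_subset b q a q').eq_or_ssubset).resolve_right hs]
      exact Prod.Lex.right _ (Nat.sub_lt (Nat.pos_of_ne_zero hn) one_pos)

end Algorithm

end

/-! Write κ = ε/(3|E|) and m = m(Γ, κ). The proof is an induction on the size s of the support of
the belief, and for fixed s on the counter n. It shows that each level costs at most 3κ, so that the
total is at most 3κ(|Supp(b)| − 1) ≤ ε.

One call of step 4 is exact up to its inputs. Until the first distinguishing pair, all environments
in the support and the MDP 𝖦 give the same probabilities to runs, so the belief does not move. At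
such a pair Bayes' rule turns the remaining payoff into the average, over the next state, of the
payoff under the updated belief, while 𝖦 pays the average of the estimates. Hence the value of 𝖦 and
the prior value differ by at most the averaged error of the estimates (`priorValue_le_value_add`,
`value_le_priorValue_add`, through `measure_le_of_exitWords`).

The errors within a level come from truncating digits, at most κ/m per step; from truncating a
belief with an environment of mass at most κ, which costs κ (`near_priorValue_truncate`); and from
reaching n = 0 while all environments of the support still have mass above κ. The last error is
controlled by a potential, the geometric mean g(b) of the belief over its support. By Bayes' rule
and Hölder's inequality the expectation of g shrinks by the factor β^(2/s) at each distinguishing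
pair, where β bounds the Bhattacharyya coefficients of distinguished environments
(`sum_next_mul_geoMean_le`). An undecided belief has g ≥ κ, so as in Markov's inequality the error
is at most β^(2n/s) g(b)/κ (`undecidedBound`). It is carried through the induction on n and needs no
event on runs.

For n = m = |E|(n₁ + n₃) it is at most κ, because β^(n₁+n₃) ≤ κ. That inequality
(`exists_affinity_bound`) comes from β = 1 − p_min ι and n₃ in general. It comes from β = 1 − p_min
and n₁ when no ratio exceeds 1, that is, when environments differ only by zero against positive
probabilities. -/

/-! ### Words and cylinders -/

section Words

variable {X : Type*}

/-- The prefix of length `n` of an infinite sequence. -/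
def word (ω : ℕ → X) (n : ℕ) : List X := (List.range n).map ω

@[simp] theorem word_zero (ω : ℕ → X) : word ω 0 = [] := rfl

@[simp] theorem length_word (ω : ℕ → X) (n : ℕ) : (word ω n).length = n := by simp [word]

theorem word_succ (ω : ℕ → X) (n : ℕ) : word ω (n + 1) = word ω n ++ [ω n] := by
  simp [word, List.range_succ]

theorem word_add (ω : ℕ → X) (n k : ℕ) :
    word ω (n + k) = word ω n ++ word (fun i => ω (n + i)) k := by
  simp [word, List.range_add]

theorem word_comp {Y : Type*} (j : X → Y) (ω : ℕ → X) (n : ℕ) :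
    word (fun i => j (ω i)) n = (word ω n).map j := by
  simp [word]

theorem mem_word {ω : ℕ → X} {n : ℕ} {x : X} : x ∈ word ω n ↔ ∃ i < n, ω i = x := by
  simp [word]

theorem ofFn_eq_word (ω : ℕ → X) (n : ℕ) : (List.ofFn fun i : Fin n => ω i) = word ω n := by
  induction n with
  | zero => rfl
  | succ n ih => rw [List.ofFn_succ', word_succ, ← ih]; simp

/-- The set of all infinite sequences that start with a given word. -/
def cyl (l : List X) : Set (ℕ → X) := {ω | word ω l.length = l}

theorem mem_cyl {l : List X} {ω : ℕ → X} : ω ∈ cyl l ↔ word ω l.length = l := Iff.rfl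

@[simp] theorem cyl_nil : cyl ([] : List X) = univ := by ext; simp [mem_cyl]

theorem mem_cyl_append {l l' : List X} {ω : ℕ → X} :
    ω ∈ cyl (l ++ l') ↔ ω ∈ cyl l ∧ (fun i => ω (l.length + i)) ∈ cyl l' := by
  rw [mem_cyl, mem_cyl, mem_cyl, List.length_append, word_add]
  exact ⟨fun h => List.append_inj h (by simp), fun h => by rw [h.1, h.2]⟩

theorem mem_cyl_singleton {x : X} {ω : ℕ → X} : ω ∈ cyl [x] ↔ ω 0 = x := by
  simp [mem_cyl, word]

theorem mem_cyl_concat {l : List X} {x : X} {ω : ℕ → X} :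
    ω ∈ cyl (l ++ [x]) ↔ ω ∈ cyl l ∧ ω l.length = x := by
  rw [mem_cyl_append, mem_cyl_singleton, add_zero]

theorem cyl_append_subset (l l' : List X) : cyl (l ++ l') ⊆ cyl l :=
  fun _ h => (mem_cyl_append.1 h).1

theorem mem_cyl_word (ω : ℕ → X) (n : ℕ) : ω ∈ cyl (word ω n) := by simp [mem_cyl]

/-- Two cylinders are disjoint or nested. -/
theorem cyl_inter_cyl (l l' : List X) :
    cyl l ∩ cyl l' = ∅ ∨ cyl l ∩ cyl l' = cyl l ∨ cyl l ∩ cyl l' = cyl l' := by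
  rcases (cyl l ∩ cyl l').eq_empty_or_nonempty with h | ⟨ω, h1, h2⟩
  · exact Or.inl h
  right
  rw [mem_cyl] at h1 h2
  wlog hl : l.length ≤ l'.length generalizing l l'
  · rw [inter_comm]
    exact (this l' l h2 h1 (by omega)).symm
  right
  obtain ⟨k, hk⟩ := Nat.exists_eq_add_of_le hl
  rw [hk, word_add, h1] at h2
  rw [← h2]
  exact inter_eq_right.2 (cyl_append_subset _ _)

theorem isPiSystem_cyl : IsPiSystem (insert ∅ (range (cyl : List X → Set (ℕ → X)))) := by
  rintro _ (rfl | ⟨l, rfl⟩) _ (rfl | ⟨l', rfl⟩) h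
  · simp at h
  · simp at h
  · simp at h
  · rcases cyl_inter_cyl l l' with h0 | h0 | h0
    · exact Or.inl h0
    · exact Or.inr ⟨l, h0.symm⟩
    · exact Or.inr ⟨l', h0.symm⟩

variable [MeasurableSpace X] [MeasurableSingletonClass X]

theorem measurableSet_cyl (l : List X) : MeasurableSet (cyl l) := by
  induction l using List.reverseRecOn with
  | nil => simp
  | append_singleton l x ih =>
    have : cyl (l ++ [x]) = cyl l ∩ (fun ω : ℕ → X => ω l.length) ⁻¹' {x} := by
      ext ω; simp [mem_cyl_concat]
    rw [this]
    exact ih.inter (measurable_pi_apply _ (measurableSet_singleton x))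

/-- An event about coordinate i is the union of the cylinders of the words of length i + 1 with a
suitable last letter, and over a countable alphabet there are countably many words. -/
theorem generateFrom_cyl [Countable X] :
    MeasurableSpace.generateFrom (insert ∅ (range (cyl : List X → Set (ℕ → X)))) =
      MeasurableSpace.pi := by
  refine le_antisymm (MeasurableSpace.generateFrom_le ?_) ?_
  · rintro _ (rfl | ⟨l, rfl⟩)
    · exact MeasurableSet.empty
    · exact measurableSet_cyl l
  · refine iSup_le fun i => ?_
    rintro _ ⟨s, -, rfl⟩
    have : (fun ω : ℕ → X => ω i) ⁻¹' s =
        ⋃ l : {l : List X // ∃ l' x, l = l' ++ [x] ∧ l'.length = i ∧ x ∈ s}, cyl l.1 := by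
      ext ω
      simp only [mem_preimage, mem_iUnion]
      constructor
      · intro h
        refine ⟨⟨word ω (i + 1), word ω i, ω i, word_succ _ _, by simp, h⟩, mem_cyl_word _ _⟩
      · rintro ⟨⟨_, l', x, rfl, rfl, hx⟩, h⟩
        rwa [(mem_cyl_concat.1 h).2]
    rw [this]
    exact MeasurableSet.iUnion fun l =>
      MeasurableSpace.measurableSet_generateFrom (Or.inr ⟨_, rfl⟩)

/-- Finite measures on infinite sequences that agree on all cylinders are equal. -/
theorem ext_of_cyl [Countable X] {μ ν : Measure (ℕ → X)} [IsFiniteMeasure μ]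
    (h : ∀ l, μ (cyl l) = ν (cyl l)) : μ = ν := by
  refine ext_of_generate_finite _ generateFrom_cyl.symm isPiSystem_cyl ?_ ?_
  · rintro _ (rfl | ⟨l, rfl⟩)
    · simp
    · exact h l
  · simpa using h []

end Words

/-! ### The run measure on cylinders -/

open scoped Classical in
theorem PMF.map_pair_apply {Q A : Type*} (p : PMF A) (q : Q) (x : Q × A) :
    (p.map fun a => (q, a)) x = if x.1 = q then p x.2 else 0 := by
  rw [PMF.map_apply]
  rcases x with ⟨q', a⟩
  simp only [Prod.mk.injEq]
  split_ifs with h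
  · rw [tsum_eq_single a]
    · simp [h]
    · intro b hb; simp [hb.symm]
  · simp [h]

namespace MDP

variable {Q A : Type*} [Fintype Q] [Fintype A]
  [MeasurableSpace Q] [MeasurableSingletonClass Q] [MeasurableSpace A] [MeasurableSingletonClass A]

theorem map_eval_zero_traj {X : Type*} [MeasurableSpace X]
    (μ₀ : Measure X) [IsProbabilityMeasure μ₀]
    (κ : (n : ℕ) → Kernel ((_ : Finset.Iic n) → X) X) [∀ n, IsMarkovKernel (κ n)] :
    (Kernel.trajMeasure (X := fun _ => X) μ₀ κ).map (fun ω => ω 0) = μ₀ := by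
  have h1 : (fun ω : ℕ → X => ω 0) =
      (MeasurableEquiv.piUnique (fun _ : Finset.Iic 0 => X)) ∘ Preorder.frestrictLe 0 := by
    ext ω; rfl
  rw [h1, ← Measure.map_map (by fun_prop) (by fun_prop), Kernel.trajMeasure,
    Measure.map_comp _ _ (by fun_prop), Kernel.traj_map_frestrictLe, Kernel.partialTraj_self,
    Measure.id_comp, Measure.map_map (by fun_prop) (by fun_prop), MeasurableEquiv.self_comp_symm,
    Measure.map_id]

open scoped Classical in
theorem runMeasure_cyl_singleton (G : MDP Q A) (σ : Strat Q A) (q : Q) (x : Q × A) :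
    G.runMeasure σ q (cyl [x]) = if x.1 = q then σ [] q x.2 else 0 := by
  have : IsProbabilityMeasure ((σ [] q).map fun a => (q, a)).toMeasure :=
    PMF.toMeasure.isProbabilityMeasure _
  have h := map_eval_zero_traj ((σ [] q).map fun a => (q, a)).toMeasure (G.stepKernel σ)
  rw [← PMF.map_pair_apply, ← PMF.toMeasure_apply_singleton _ _ (measurableSet_singleton x), ← h,
    Measure.map_apply (by fun_prop) (measurableSet_singleton x)]
  unfold runMeasure
  congr 1
  ext ω
  simp [mem_cyl_singleton]

theorem stepKernel_singleton (G : MDP Q A) (σ : Strat Q A) (n : ℕ)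
    (h : (_ : Finset.Iic n) → Q × A) (x : Q × A) :
    G.stepKernel σ n h {x} =
      G.δ (h ⟨n, Finset.mem_Iic.2 le_rfl⟩).1 (h ⟨n, Finset.mem_Iic.2 le_rfl⟩).2 x.1 *
      σ (List.ofFn fun i : Fin (n + 1) => h ⟨i, Finset.mem_Iic.2 (Nat.lt_succ_iff.1 i.2)⟩) x.1
        x.2 := by
  change PMF.toMeasure _ {x} = _
  rw [PMF.toMeasure_apply_singleton _ _ (measurableSet_singleton x), PMF.bind_apply,
    tsum_eq_single x.1]
  · rw [PMF.map_pair_apply]; simp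
  · intro q' hq'
    rw [PMF.map_pair_apply]; simp [hq'.symm]

/-- The law of a prefix together with the next letter is the composition product of the law of the
prefix with the step kernel; evaluate it on the singleton of the prefix and the letter. -/
theorem runMeasure_cyl_concat (G : MDP Q A) (σ : Strat Q A) (q : Q) (l : List (Q × A))
    (y x : Q × A) :
    G.runMeasure σ q (cyl (l ++ [y] ++ [x])) =
      G.runMeasure σ q (cyl (l ++ [y])) * (G.δ y.1 y.2 x.1 * σ (l ++ [y]) x.1 x.2) := by
  have : IsProbabilityMeasure ((σ [] q).map fun a => (q, a)).toMeasure :=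
    PMF.toMeasure.isProbabilityMeasure _
  have h := Kernel.map_frestrictLe_trajMeasure_compProd_eq_map_trajMeasure (X := fun _ => Q × A)
    (μ₀ := ((σ [] q).map fun a => (q, a)).toMeasure) (κ := G.stepKernel σ) (a := l.length)
  -- Any run in the cylinder serves to turn the list into the tuple `u` on which the kernel acts.
  by_cases hne : (cyl (l ++ [y] ++ [x])).Nonempty
  swap
  · exfalso
    refine hne ⟨fun i => if hi : i < (l ++ [y] ++ [x]).length then (l ++ [y] ++ [x])[i] else x, ?_⟩
    rw [mem_cyl, ← ofFn_eq_word]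
    refine List.ext_getElem (by simp) fun i h₁ h₂ => ?_
    rw [List.getElem_ofFn, dif_pos h₂]
  obtain ⟨ω₀, hω₀⟩ := hne
  rw [mem_cyl_concat] at hω₀
  obtain ⟨h1, h2⟩ := hω₀
  have h1' := (mem_cyl_concat.1 h1).2
  rw [mem_cyl] at h1
  simp only [List.length_append, List.length_singleton] at h1 h2
  set u : (_ : Finset.Iic l.length) → Q × A := Preorder.frestrictLe l.length ω₀ with hu
  have hcyl : ∀ ω : ℕ → Q × A, Preorder.frestrictLe (π := fun _ => Q × A) l.length ω = u ↔
      ω ∈ cyl (l ++ [y]) := by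
    intro ω
    rw [mem_cyl, ← h1]
    simp only [hu, word, List.length_map, List.length_range, List.map_inj_left, List.mem_range]
    constructor
    · intro hh i hi
      exact congrFun hh ⟨i, Finset.mem_Iic.2 (by omega)⟩
    · intro hh
      ext1 i
      exact hh i.1 (by have := Finset.mem_Iic.1 i.2; omega)
  have h3 := DFunLike.congr_fun h ({u} ×ˢ {x})
  rw [Measure.compProd_apply_prod (measurableSet_singleton u) (measurableSet_singleton x),
    lintegral_singleton, Measure.map_apply (by fun_prop) (measurableSet_singleton u),
    Measure.map_apply (by fun_prop) ((measurableSet_singleton u).prod (measurableSet_singleton x)),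
    stepKernel_singleton] at h3
  have e1 : (Preorder.frestrictLe (π := fun _ => Q × A) l.length) ⁻¹' {u} = cyl (l ++ [y]) := by
    ext ω; exact hcyl ω
  have e2 : (fun ω : ℕ → Q × A => (Preorder.frestrictLe (π := fun _ => Q × A) l.length ω,
      ω (l.length + 1))) ⁻¹' ({u} ×ˢ {x}) = cyl (l ++ [y] ++ [x]) := by
    ext ω
    rw [mem_cyl_concat, ← hcyl]
    simp
  have e3 : u ⟨l.length, Finset.mem_Iic.2 le_rfl⟩ = y := h1'
  have e4 : (List.ofFn fun i : Fin (l.length + 1) =>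
      u ⟨i, Finset.mem_Iic.2 (Nat.lt_succ_iff.1 i.2)⟩) = l ++ [y] := by
    rw [← h1, ← ofFn_eq_word]; rfl
  rw [e1, e2, e3, e4] at h3
  unfold runMeasure
  rw [← h3, mul_comm]

/-- The run measure is determined by its recursion on cylinders. -/
theorem eq_runMeasure (G : MDP Q A) (σ : Strat Q A) (q : Q) (μ : Measure (ℕ → Q × A))
    [IsFiniteMeasure μ] (h₁ : μ univ = 1)
    (h₀ : ∀ x, μ (cyl [x]) = G.runMeasure σ q (cyl [x]))
    (hs : ∀ l y x, μ (cyl (l ++ [y] ++ [x])) =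
      μ (cyl (l ++ [y])) * (G.δ y.1 y.2 x.1 * σ (l ++ [y]) x.1 x.2)) :
    μ = G.runMeasure σ q := by
  refine ext_of_cyl fun l => ?_
  induction l using List.reverseRecOn with
  | nil => simp [h₁]
  | append_singleton l x ih =>
    rcases List.eq_nil_or_concat l with rfl | ⟨l, y, rfl⟩
    · simpa using h₀ x
    · rw [List.concat_eq_append] at *
      rw [hs, runMeasure_cyl_concat, ih]

theorem runMeasure_cyl_cons_of_ne (G : MDP Q A) (σ : Strat Q A) (q : Q) (x : Q × A)
    (l : List (Q × A)) (h : x.1 ≠ q) : G.runMeasure σ q (cyl (x :: l)) = 0 := by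
  refine measure_mono_null (cyl_append_subset [x] l) ?_
  rw [runMeasure_cyl_singleton, if_neg h]

/-- The run measure depends only on the histories that start in the initial state. -/
theorem runMeasure_congr (G : MDP Q A) (σ σ' : Strat Q A) (q : Q)
    (h₀ : σ [] q = σ' [] q) (h : ∀ x l q', x.1 = q → σ (x :: l) q' = σ' (x :: l) q') :
    G.runMeasure σ q = G.runMeasure σ' q := by
  refine eq_runMeasure _ _ _ _ measure_univ (fun x => ?_) fun l y x => ?_
  · rw [runMeasure_cyl_singleton, runMeasure_cyl_singleton, h₀]
  · rw [runMeasure_cyl_concat]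
    obtain ⟨z, l', hz⟩ : ∃ z l', l ++ [y] = z :: l' := List.exists_cons_of_ne_nil (by simp)
    rw [hz]
    by_cases hq : z.1 = q
    · rw [h _ _ _ hq]
    · rw [runMeasure_cyl_cons_of_ne _ _ _ _ _ hq]; simp

/-- The strategy that remains after a history. -/
def _root_.Strat.after (σ : Strat Q A) (h : List (Q × A)) : Strat Q A := fun l q => σ (h ++ l) q

/-- The Markov property. -/
theorem runMeasure_cyl_inter_shift (G : MDP Q A) (σ : Strat Q A) (q : Q) (l : List (Q × A))
    (y : Q × A) (B : Set (ℕ → Q × A)) (hB : MeasurableSet B) :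
    G.runMeasure σ q (cyl (l ++ [y]) ∩ {ω | (fun i => ω ((l ++ [y]).length + i)) ∈ B}) =
      G.runMeasure σ q (cyl (l ++ [y])) *
        ∑ q', G.δ y.1 y.2 q' * G.runMeasure (Strat.after σ (l ++ [y])) q' B := by
  classical
  set h := l ++ [y] with hh
  have hm : Measurable fun (ω : ℕ → Q × A) i => ω (h.length + i) := by fun_prop
  set μ : Measure (ℕ → Q × A) :=
    ((G.runMeasure σ q).restrict (cyl h)).map fun ω i => ω (h.length + i) with hμ
  set ν : Measure (ℕ → Q × A) := G.runMeasure σ q (cyl h) •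
    ∑ q', G.δ y.1 y.2 q' • G.runMeasure (Strat.after σ h) q' with hν
  have hνB : ∀ B, ν B = G.runMeasure σ q (cyl h) *
      ∑ q', G.δ y.1 y.2 q' * G.runMeasure (Strat.after σ h) q' B := by
    intro B; simp [hν]
  have hμB : ∀ B, MeasurableSet B → μ B =
      G.runMeasure σ q (cyl h ∩ {ω | (fun i => ω (h.length + i)) ∈ B}) := by
    intro B hB
    rw [hμ, Measure.map_apply hm hB, Measure.restrict_apply (hm hB), inter_comm]
    rfl
  have hμc : ∀ l', μ (cyl l') = G.runMeasure σ q (cyl (h ++ l')) := by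
    intro l'
    rw [hμB _ (measurableSet_cyl _)]
    congr 1
    ext ω
    exact mem_cyl_append.symm
  -- Both sides are finite measures as functions of `B`, so it is enough to compare them on
  -- cylinders.
  have key : μ = ν := by
    refine ext_of_cyl fun l' => ?_
    induction l' using List.reverseRecOn with
    | nil =>
      rw [hμc, hνB]
      have := (G.δ y.1 y.2).tsum_coe
      rw [tsum_fintype] at this
      simp [this]
    | append_singleton l' x ih =>
      rcases List.eq_nil_or_concat l' with rfl | ⟨l', z, rfl⟩
      · rw [hμc, hνB, List.nil_append, hh, runMeasure_cyl_concat]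
        congr 1
        simp only [runMeasure_cyl_singleton]
        simp [Strat.after]
      · rw [List.concat_eq_append] at *
        rw [hμc, hνB] at *
        have e : h ++ (l' ++ [z] ++ [x]) = h ++ l' ++ [z] ++ [x] := by simp
        rw [e, runMeasure_cyl_concat, List.append_assoc, ih]
        simp only [runMeasure_cyl_concat, Finset.sum_mul, mul_assoc, Strat.after]
  rw [← hμB B hB, key, hνB]

theorem ae_eq_of_sink (G : MDP Q A) (σ : Strat Q A) (q : Q) (hq : ∀ a, G.δ q a = PMF.pure q) :
    ∀ᵐ ω ∂G.runMeasure σ q, ∀ i, (ω i).1 = q := by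
  have key : ∀ (l : List (Q × A)) (x : Q × A), x.1 ≠ q →
      G.runMeasure σ q (cyl (l ++ [x])) = 0 := by
    intro l
    induction l using List.reverseRecOn with
    | nil => intro x hx; exact runMeasure_cyl_cons_of_ne _ _ _ _ _ hx
    | append_singleton l y ih =>
      intro x hx
      rw [runMeasure_cyl_concat]
      by_cases hy : y.1 = q
      · rw [hy, hq, PMF.pure_apply, if_neg hx]; simp
      · rw [ih y hy, zero_mul]
  rw [ae_all_iff]
  intro i
  rw [ae_iff]
  have : {ω : ℕ → Q × A | ¬(ω i).1 = q} ⊆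
      ⋃ l : {l : List (Q × A) // ∃ l' x, l = l' ++ [x] ∧ x.1 ≠ q}, cyl l.1 := by
    intro ω hω
    exact mem_iUnion.2 ⟨⟨word ω (i + 1), _, _, word_succ _ _, hω⟩, mem_cyl_word _ _⟩
  refine measure_mono_null this (measure_iUnion_null ?_)
  rintro ⟨_, l', x, rfl, hx⟩
  exact key l' x hx

end MDP

/-! ### The parity objective -/

section Parity

variable {Q : Type*}

theorem parityObjective_shift (c : Q → ℕ) (ρ : ℕ → Q) (n : ℕ) :
    (fun i => ρ (n + i)) ∈ parityObjective c ↔ ρ ∈ parityObjective c := by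
  have : {k : ℕ | ∀ i, ∃ j ≥ i, c (ρ (n + j)) = k} = {k : ℕ | ∀ i, ∃ j ≥ i, c (ρ j) = k} := by
    ext k
    constructor
    · intro h i
      obtain ⟨j, hj, e⟩ := h i
      exact ⟨n + j, by omega, e⟩
    · intro h i
      obtain ⟨j, hj, e⟩ := h (n + i)
      exact ⟨j - n, by omega, by rwa [Nat.add_sub_cancel' (by omega)]⟩
  simp only [parityObjective, mem_ofPred_eq, this]

theorem mem_parityObjective_of_const (c : Q → ℕ) (ρ : ℕ → Q) (q : Q) (h : ∀ i, ρ i = q) :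
    ρ ∈ parityObjective c ↔ Even (c q) := by
  have : {k : ℕ | ∀ i, ∃ j ≥ i, c (ρ j) = k} = {c q} := by
    ext k
    simp only [h, mem_ofPred_eq, mem_singleton_iff]
    exact ⟨fun hh => (hh 0).choose_spec.2.symm, fun hh i => ⟨i, le_rfl, hh.symm⟩⟩
  simp only [parityObjective, mem_ofPred_eq, this, csSup_singleton]

theorem measurableSet_parityObjective [Finite Q] [MeasurableSpace Q] [MeasurableSingletonClass Q]
    (c : Q → ℕ) : MeasurableSet (parityObjective c) := by
  -- There are finitely many labels, so the set of recurring labels takes finitely many values; the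
  -- objective is a finite union of fibres of `f`.
  let f : (ℕ → Q) → Set (range c) := fun ρ => {k | ∀ i, ∃ j ≥ i, c (ρ j) = k}
  have hf : ∀ T, MeasurableSet (f ⁻¹' {T}) := by
    intro T
    have : f ⁻¹' {T} = ⋂ k : range c, {ρ | (∀ i, ∃ j ≥ i, c (ρ j) = k) ↔ k ∈ T} := by
      ext ρ
      simp only [mem_preimage, mem_singleton_iff, Set.ext_iff, mem_iInter]
      rfl
    rw [this]
    refine MeasurableSet.iInter fun k => ?_
    have h1 : MeasurableSet {ρ : ℕ → Q | ∀ i, ∃ j ≥ i, c (ρ j) = k} := by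
      have : {ρ : ℕ → Q | ∀ i, ∃ j ≥ i, c (ρ j) = k} =
          ⋂ i, ⋃ j, ⋃ _ : j ≥ i, (fun ρ : ℕ → Q => ρ j) ⁻¹' {q | c q = k} := by
        ext ρ; simp
      rw [this]
      exact .iInter fun i => .iUnion fun j => .iUnion fun _ =>
        measurable_pi_apply j (Set.toFinite _).measurableSet
    by_cases hk : k ∈ T
    · simpa [hk] using h1
    · have : {ρ : ℕ → Q | (∀ i, ∃ j ≥ i, c (ρ j) = k) ↔ k ∈ T} =
          {ρ : ℕ → Q | ∀ i, ∃ j ≥ i, c (ρ j) = k}ᶜ := by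
        ext ρ; simp only [hk, iff_false]; rfl
      rw [this]
      exact h1.compl
  have : parityObjective c = ⋃ T ∈ {T : Set (range c) | Even (sSup ((↑) '' T : Set ℕ))},
      f ⁻¹' {T} := by
    ext ρ
    have e : {k : ℕ | ∀ i, ∃ j ≥ i, c (ρ j) = k} = (↑) '' f ρ := by
      ext k
      constructor
      · intro h
        obtain ⟨j, -, hj⟩ := h 0
        exact ⟨⟨k, _, hj⟩, h, rfl⟩
      · rintro ⟨⟨_, hk⟩, h, rfl⟩
        exact h
    simp [parityObjective, e]
  rw [this]
  exact MeasurableSet.biUnion (Set.toFinite _).countable fun T _ => hf T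

end Parity

/-! ### Decomposition at the first exit from a set of letters -/

section Exit

variable {X : Type*}

/-- The words that leave `K` exactly with their last letter, split off that letter. -/
def exitWords (K : Set X) : Set (List X × X) := {p | (∀ x ∈ p.1, x ∈ K) ∧ p.2 ∉ K}

theorem disjoint_cyl_exitWords {K : Set X} {p p' : List X × X} (hp : p ∈ exitWords K)
    (hp' : p' ∈ exitWords K) (hne : p ≠ p') :
    Disjoint (cyl (p.1 ++ [p.2])) (cyl (p'.1 ++ [p'.2])) := by
  rw [Set.disjoint_left]
  intro ω h h'
  rw [mem_cyl_concat, mem_cyl] at h h'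
  rcases lt_trichotomy p.1.length p'.1.length with hl | hl | hl
  · refine hp.2 (hp'.1 _ ?_)
    rw [← h.2, ← h'.1]
    exact mem_word.2 ⟨_, hl, rfl⟩
  · exact hne (Prod.ext (by rw [← h.1, ← h'.1, hl]) (by rw [← h.2, ← h'.2, hl]))
  · refine hp'.2 (hp.1 _ ?_)
    rw [← h.1, ← h'.2]
    exact mem_word.2 ⟨_, hl, rfl⟩

theorem iUnion_cyl_exitWords (K : Set X) :
    ⋃ p : exitWords K, cyl (p.1.1 ++ [p.1.2]) = {ω : ℕ → X | ∀ i, ω i ∈ K}ᶜ := by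
  classical
  ext ω
  simp only [mem_iUnion, mem_compl_iff, mem_ofPred_eq, not_forall]
  constructor
  · rintro ⟨⟨p, hp⟩, h⟩
    refine ⟨p.1.length, ?_⟩
    rw [(mem_cyl_concat.1 h).2]
    exact hp.2
  · intro h
    refine ⟨⟨(word ω (Nat.find h), ω (Nat.find h)), fun x hx => ?_, Nat.find_spec h⟩, ?_⟩
    · obtain ⟨i, hi, rfl⟩ := mem_word.1 hx
      exact not_not.1 (Nat.find_min h hi)
    · rw [← word_succ]
      exact mem_cyl_word _ _

variable [MeasurableSpace X] [MeasurableSingletonClass X] [Countable X]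

theorem measurableSet_forall_mem (K : Set X) : MeasurableSet {ω : ℕ → X | ∀ i, ω i ∈ K} := by
  have := iUnion_cyl_exitWords K
  rw [← compl_compl {ω : ℕ → X | ∀ i, ω i ∈ K}, ← this]
  exact (MeasurableSet.iUnion fun p => measurableSet_cyl _).compl

theorem measure_eq_add_tsum_exitWords (μ : Measure (ℕ → X)) (K : Set X) (B : Set (ℕ → X)) :
    μ B = μ (B ∩ {ω | ∀ i, ω i ∈ K}) + ∑' p : exitWords K, μ (B ∩ cyl (p.1.1 ++ [p.1.2])) := by
  rw [← measure_inter_add_sdiff B (measurableSet_forall_mem K), sdiff_eq, ← iUnion_cyl_exitWords]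
  congr 1
  have h : ∀ C : Set (ℕ → X), MeasurableSet C → μ (B ∩ C) = μ.restrict B C := fun C hC => by
    rw [Measure.restrict_apply hC, inter_comm]
  rw [h _ (MeasurableSet.iUnion fun p => measurableSet_cyl _), measure_iUnion]
  · exact tsum_congr fun p => (h _ (measurableSet_cyl _)).symm
  · intro p p' hne
    exact disjoint_cyl_exitWords p.2 p'.2 fun h => hne (Subtype.ext h)
  · exact fun p => measurableSet_cyl _

/-- Two measures that agree on all words that have at most their last letter outside `K` agree on
the sequences that stay in `K`. -/
theorem restrict_forall_mem_eq {μ ν : Measure (ℕ → X)} [IsFiniteMeasure μ] [IsFiniteMeasure ν]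
    {K : Set X} (huniv : μ univ = ν univ)
    (h : ∀ l x, (∀ y ∈ l, y ∈ K) → μ (cyl (l ++ [x])) = ν (cyl (l ++ [x]))) :
    μ.restrict {ω | ∀ i, ω i ∈ K} = ν.restrict {ω | ∀ i, ω i ∈ K} := by
  refine ext_of_cyl fun l => ?_
  rw [Measure.restrict_apply (measurableSet_cyl l), Measure.restrict_apply (measurableSet_cyl l)]
  by_cases hl : ∀ y ∈ l, y ∈ K
  · have hcyl : μ (cyl l) = ν (cyl l) := by
      rcases List.eq_nil_or_concat l with rfl | ⟨l, y, rfl⟩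
      · simpa using huniv
      · rw [List.concat_eq_append] at *
        exact h l y fun z hz => hl z (by simp [hz])
    -- A cylinder is its part that stays in `K` plus its exit cylinders. The measures agree on the
    -- whole cylinder and on every exit part, so subtracting the finite sum leaves agreement on the
    -- first part.
    have h1 := measure_eq_add_tsum_exitWords μ K (cyl l)
    have h2 := measure_eq_add_tsum_exitWords ν K (cyl l)
    have h3 : ∑' p : exitWords K, μ (cyl l ∩ cyl (p.1.1 ++ [p.1.2])) =
        ∑' p : exitWords K, ν (cyl l ∩ cyl (p.1.1 ++ [p.1.2])) := by
      refine tsum_congr fun p => ?_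
      rcases cyl_inter_cyl l (p.1.1 ++ [p.1.2]) with h0 | h0 | h0
      · simp [h0]
      · rw [h0, hcyl]
      · rw [h0, h _ _ p.2.1]
    rw [h3] at h1
    rw [hcyl] at h1
    refine (ENNReal.add_left_inj (a := ∑' p : exitWords K, ν (cyl l ∩ cyl (p.1.1 ++ [p.1.2])))
      ?_).1 (h1.symm.trans h2)
    refine ne_top_of_le_ne_top (measure_ne_top ν (cyl l)) ?_
    rw [h2]
    exact le_add_self
  · have : cyl l ∩ {ω : ℕ → X | ∀ i, ω i ∈ K} = ∅ := by
      ext ω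
      simp only [mem_inter_iff, mem_ofPred_eq, mem_empty_iff_false, iff_false, not_and]
      intro hω hK
      refine hl fun y hy => ?_
      rw [mem_cyl] at hω
      rw [← hω] at hy
      obtain ⟨i, -, rfl⟩ := mem_word.1 hy
      exact hK i
    simp [this]

/-- Comparison of two measures that agree up to the first exit from `K`. -/
theorem measure_le_of_exitWords {μ ν : Measure (ℕ → X)} [IsProbabilityMeasure μ]
    [IsProbabilityMeasure ν] {K : Set X}
    (h : ∀ l x, (∀ y ∈ l, y ∈ K) → μ (cyl (l ++ [x])) = ν (cyl (l ++ [x])))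
    {B : Set (ℕ → X)} (hB : MeasurableSet B) (d : ℝ≥0∞)
    (hd : ∀ p ∈ exitWords K, μ (B ∩ cyl (p.1 ++ [p.2])) ≤
      ν (B ∩ cyl (p.1 ++ [p.2])) + ν (cyl (p.1 ++ [p.2])) * d) :
    μ B ≤ ν B + d := by
  rw [measure_eq_add_tsum_exitWords μ K B, measure_eq_add_tsum_exitWords ν K B]
  have h1 := DFunLike.congr_fun (restrict_forall_mem_eq (by simp) h) B
  rw [Measure.restrict_apply hB, Measure.restrict_apply hB] at h1
  rw [h1, add_assoc]
  gcongr
  calc ∑' p : exitWords K, μ (B ∩ cyl (p.1.1 ++ [p.1.2]))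
      ≤ ∑' p : exitWords K, (ν (B ∩ cyl (p.1.1 ++ [p.1.2])) + ν (cyl (p.1.1 ++ [p.1.2])) * d) :=
        ENNReal.tsum_le_tsum fun p => hd p.1 p.2
    _ = ∑' p : exitWords K, ν (B ∩ cyl (p.1.1 ++ [p.1.2])) +
        (∑' p : exitWords K, ν (univ ∩ cyl (p.1.1 ++ [p.1.2]))) * d := by
      rw [ENNReal.tsum_add, ENNReal.tsum_mul_right]
      simp
    _ ≤ ∑' p : exitWords K, ν (B ∩ cyl (p.1.1 ++ [p.1.2])) + 1 * d := by
      gcongr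
      -- The exit cylinders are disjoint and have total mass at most 1, so the error `d` at the exit
      -- is averaged and does not accumulate.
      have h2 := measure_eq_add_tsum_exitWords ν K univ
      rw [measure_univ] at h2
      rw [h2]
      exact le_add_self
    _ = _ := by rw [one_mul]

end Exit

/-! ### Beliefs and the win probability -/

namespace MEMDP

variable {Q A E : Type*}

/-- Bayes' rule without division. It survives at states of probability zero, where the updated
belief is meaningless but both sides vanish. -/
theorem next_mul_update_apply (Γ : MEMDP Q A E) (b : PMF E) (q : Q) (a : A) (q' : Q) (e : E) :
    Γ.next b q a q' * Γ.update b q a q' e = b e * (Γ.env e).δ q a q' := by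
  by_cases h : Γ.next b q a q' = 0
  · rw [h, zero_mul]
    rw [next_apply, ENNReal.tsum_eq_zero] at h
    exact (h e).symm
  · rw [update_apply _ _ _ _ _ h, ENNReal.mul_div_cancel h ((Γ.next b q a).apply_ne_top q')]

theorem winProb_eq [Fintype Q] (Γ : MEMDP Q A E) (b : PMF E) (v : Q → A → Q → unitInterval)
    (q : Q) (a : A) :
    Γ.winProb b v q a = ∑ q', Γ.next b q a q' * ENNReal.ofReal (v q a q') := by
  classical
  rw [winProb, ← tsum_fintype (L := .unconditional _)]
  simp only [ENNReal.tsum_mul_right, ← next_apply]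
  refine tsum_subtype_eq_of_support_subset
    (f := fun q' => Γ.next b q a q' * ENNReal.ofReal (v q a q')) ?_
  intro q' h
  exact left_ne_zero_of_mul h

variable (Γ : MEMDP Q A E) (b : PMF E) (v : Q → A → Q → unitInterval)

theorem mdpFromMEMDP_inl_of_notMem {q : Q} {a : A} (h : (q, a) ∉ Γ.dstg b.support) {e : E}
    (he : e ∈ b.support) :
    (mdpFromMEMDP Γ b v).δ (Sum.inl q) a = ((Γ.env e).δ q a).map Sum.inl := by
  simp only [mdpFromMEMDP, if_neg h]
  congr 1
  by_contra hne
  exact h ⟨_, b.support_nonempty.some_mem, e, he, hne⟩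

theorem mdpFromMEMDP_inl_of_mem {q : Q} {a : A} (h : (q, a) ∈ Γ.dstg b.support) :
    (mdpFromMEMDP Γ b v).δ (Sum.inl q) a =
      sinkPMF Q (Γ.winProb b v q a) (Γ.winProb_le_one b v q a) := by
  simp only [mdpFromMEMDP, if_pos h]

end MEMDP

/-! ### Pushforwards and the two sinks -/

theorem PMF.map_apply_of_injective {α β : Type*} (p : PMF α) {f : α → β}
    (hf : Function.Injective f) (x : α) : p.map f (f x) = p x := by
  classical
  rw [PMF.map_apply, tsum_eq_single x]
  · simp
  · intro y hy
    rw [if_neg fun h => hy (hf h).symm]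

theorem PMF.map_apply_of_notMem_range {α β : Type*} (p : PMF α) {f : α → β} {y : β}
    (hy : y ∉ range f) : p.map f y = 0 := by
  classical
  rw [PMF.map_apply, ENNReal.tsum_eq_zero]
  intro x
  rw [if_neg fun h => hy ⟨x, h.symm⟩]

theorem sinkPMF_inr_true (Q : Type*) (w : ℝ≥0∞) (hw : w ≤ 1) :
    sinkPMF Q w hw (Sum.inr true) = w := by
  rw [sinkPMF, PMF.map_apply_of_injective _ Sum.inr_injective]
  simp

theorem sinkPMF_inl (Q : Type*) (w : ℝ≥0∞) (hw : w ≤ 1) (q : Q) :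
    sinkPMF Q w hw (Sum.inl q) = 0 :=
  PMF.map_apply_of_notMem_range _ (by simp)

section Sink

variable {Q A E : Type*} [Fintype Q] [Fintype A]
  [MeasurableSpace Q] [MeasurableSingletonClass Q] [MeasurableSpace A] [MeasurableSingletonClass A]

theorem MDP.prob_of_sink (G : MDP Q A) (σ : Strat Q A) (q : Q) (hq : ∀ a, G.δ q a = PMF.pure q)
    (c : Q → ℕ) [Decidable (Even (c q))] :
    G.prob σ q (parityObjective c) = if Even (c q) then 1 else 0 := by
  have h : ∀ᵐ ω ∂G.runMeasure σ q,
      (ω ∈ {ω : ℕ → Q × A | (fun i => (ω i).1) ∈ parityObjective c} ↔ Even (c q)) := by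
    filter_upwards [G.ae_eq_of_sink σ q hq] with ω hω
    exact mem_parityObjective_of_const c _ q hω
  rw [MDP.prob]
  split_ifs with hc
  · rw [← measure_univ (μ := G.runMeasure σ q)]
    refine measure_congr ?_
    filter_upwards [h] with ω hω
    exact propext ⟨fun _ => trivial, fun _ => hω.2 hc⟩
  · refine measure_mono_null ?_ (ae_iff.1 h)
    intro ω hω hh
    exact hc (hh.1 hω)

end Sink

/-! ### Comparison of an MEMDP with the MDP built from it -/

namespace MEMDP

section Embedding

variable {Q A : Type*}

/-- The embedding of the state-action pairs of an MEMDP into those of the MDP built from it. -/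
def embPair (x : Q × A) : (Q ⊕ Bool) × A := (Sum.inl x.1, x.2)

theorem embPair_injective : Function.Injective (embPair : Q × A → (Q ⊕ Bool) × A) := by
  rintro ⟨q, a⟩ ⟨q', a'⟩ h
  simpa [embPair] using h

/-- The strategy `τ` in the MDP built from an MEMDP plays as `σ` until the first pair of `D`. -/
def Agree (D : Set (Q × A)) (σ : Strat Q A) (τ : Strat (Q ⊕ Bool) A) : Prop :=
  ∀ h, (∀ y ∈ h, y ∉ D) → ∀ q, τ (h.map embPair) (Sum.inl q) = σ h q

theorem preimage_embRun_cyl_inr (l : List ((Q ⊕ Bool) × A)) (s : Bool) (a : A) :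
    (fun (ω : ℕ → Q × A) i => (embPair (ω i) : (Q ⊕ Bool) × A)) ⁻¹' cyl (l ++ [(Sum.inr s, a)]) =
      ∅ := by
  ext ω
  rw [mem_preimage, mem_cyl_concat]
  simp [embPair]

theorem exists_map_embPair {K : Set (Q × A)} {l : List ((Q ⊕ Bool) × A)}
    (hl : ∀ y ∈ l, y ∈ embPair '' K) : ∃ h : List (Q × A), (∀ y ∈ h, y ∈ K) ∧ l = h.map embPair := by
  induction l with
  | nil => exact ⟨[], by simp, rfl⟩
  | cons y l ih =>
    obtain ⟨h, hK, rfl⟩ := ih fun z hz => hl z (by simp [hz])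
    obtain ⟨x, hx, rfl⟩ := hl y (by simp)
    exact ⟨x :: h, by simpa using ⟨hx, fun a b hab => hK _ hab⟩, rfl⟩

/-- Besides the genuine exits there are words ending in a sink letter. They have to be listed but
turn out to be null, since a sink is entered only after a pair of `D`. -/
theorem exitWords_image_cases {D : Set (Q × A)} {p : List ((Q ⊕ Bool) × A) × ((Q ⊕ Bool) × A)}
    (hp : p ∈ exitWords (embPair '' Dᶜ)) :
    ∃ h : List (Q × A), (∀ y ∈ h, y ∉ D) ∧ ((∃ x ∈ D, p = (h.map embPair, embPair x)) ∨
      ∃ s a, p = (h.map embPair, (Sum.inr s, a))) := by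
  obtain ⟨l, y⟩ := p
  obtain ⟨hl, hy⟩ := hp
  dsimp only at hl hy
  obtain ⟨h, hh, rfl⟩ := exists_map_embPair hl
  refine ⟨h, hh, ?_⟩
  rcases y with ⟨q' | s, a⟩
  · refine Or.inl ⟨(q', a), ?_, rfl⟩
    by_contra hx
    exact hy ⟨_, hx, rfl⟩
  · exact Or.inr ⟨s, a, rfl⟩

theorem preimage_embRun_cyl (l : List (Q × A)) :
    (fun (ω : ℕ → Q × A) i => (embPair (ω i) : (Q ⊕ Bool) × A)) ⁻¹' cyl (l.map embPair) =
      cyl l := by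
  ext ω
  rw [mem_preimage, mem_cyl, word_comp, List.length_map, mem_cyl]
  exact (List.map_injective_iff.2 embPair_injective).eq_iff

open scoped Classical in
/-- Play `τ` up to the first pair `x` of `D`, then continue with the strategy `opt x q'`, where `q'`
is the next state. -/
noncomputable def switchStrat (D : Set (Q × A)) (τ : Strat (Q ⊕ Bool) A)
    (opt : Q × A → Q → Strat Q A) : Strat Q A := fun h q =>
  match h.dropWhile fun x => x ∉ D with
  | [] => τ (h.map embPair) (Sum.inl q)
  -- The state entered right after `x` is the first state of `l`, or the current state `q` if `l` is
  -- empty.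
  | x :: l => opt x ((l.map Prod.fst).headD q) l q

theorem agree_switchStrat (D : Set (Q × A)) (τ : Strat (Q ⊕ Bool) A)
    (opt : Q × A → Q → Strat Q A) : Agree D (switchStrat D τ opt) τ := by
  classical
  intro h hh q
  have : h.dropWhile (fun x => decide (x ∉ D)) = [] := by
    rw [List.dropWhile_eq_nil_iff]
    simpa using hh
  simp only [switchStrat, this]

theorem switchStrat_after {D : Set (Q × A)} (τ : Strat (Q ⊕ Bool) A)
    (opt : Q × A → Q → Strat Q A) {h : List (Q × A)} (hh : ∀ y ∈ h, y ∉ D) {x : Q × A}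
    (hx : x ∈ D) (l : List (Q × A)) (q : Q) :
    Strat.after (switchStrat D τ opt) (h ++ [x]) l q =
      opt x ((l.map Prod.fst).headD q) l q := by
  classical
  have : (h ++ [x] ++ l).dropWhile (fun x => decide (x ∉ D)) = x :: l := by
    rw [List.append_assoc, List.dropWhile_append_of_pos (by simpa using hh)]
    simp [hx]
  simp only [Strat.after, switchStrat, this]

end Embedding

theorem measurableSet_parity_runs {Q A : Type*} [Finite Q] [MeasurableSpace Q]
    [MeasurableSingletonClass Q] [MeasurableSpace A] (c : Q → ℕ) :
    MeasurableSet {ω : ℕ → Q × A | (fun i => (ω i).1) ∈ parityObjective c} :=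
  (measurableSet_parityObjective c).preimage (by fun_prop)

variable {Q A E : Type*} [Fintype Q] [Fintype A]
  [MeasurableSpace Q] [MeasurableSingletonClass Q] [MeasurableSpace A] [MeasurableSingletonClass A]

variable (Γ : MEMDP Q A E) (b : PMF E) (v : Q → A → Q → unitInterval)
  {σ : Strat Q A} {τ : Strat (Q ⊕ Bool) A}

/-- Only the pairs of `h` determine transitions, and these were copied into the new MDP from the
common distribution of the environments. The last letter `x` may itself be distinguishing. -/
theorem runMeasure_cyl_eq (hστ : Agree (Γ.dstg b.support) σ τ) {e : E} (he : e ∈ b.support)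
    (q : Q) (h : List (Q × A)) (hh : ∀ y ∈ h, y ∉ Γ.dstg b.support) (x : Q × A) :
    (Γ.env e).runMeasure σ q (cyl (h ++ [x])) =
      (mdpFromMEMDP Γ b v).runMeasure τ (Sum.inl q) (cyl (h.map embPair ++ [embPair x])) := by
  classical
  induction h using List.reverseRecOn generalizing x with
  | nil =>
    have := hστ [] (by simp) q
    rw [List.map_nil] at this
    simp only [List.nil_append, List.map_nil, MDP.runMeasure_cyl_singleton, this]
    simp [embPair]
  | append_singleton h y ih =>
    have h1 := hστ (h ++ [y]) hh x.1
    rw [List.map_append, List.map_singleton] at h1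
    rw [MDP.runMeasure_cyl_concat, List.map_append, List.map_singleton, MDP.runMeasure_cyl_concat,
      ih fun z hz => hh z (by simp [hz])]
    congr 2
    · change _ = (mdpFromMEMDP Γ b v).δ (Sum.inl y.1) y.2 (Sum.inl x.1)
      rw [Γ.mdpFromMEMDP_inl_of_notMem b v (hh y (by simp)) he,
        PMF.map_apply_of_injective _ Sum.inl_injective]
    · change _ = τ _ (Sum.inl x.1) x.2
      rw [h1]

theorem runMeasure_cyl_inr_eq_zero (q : Q) (h : List (Q × A))
    (hh : ∀ y ∈ h, y ∉ Γ.dstg b.support) (s : Bool) (a : A) :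
    (mdpFromMEMDP Γ b v).runMeasure τ (Sum.inl q) (cyl (h.map embPair ++ [(Sum.inr s, a)])) =
      0 := by
  classical
  rcases List.eq_nil_or_concat h with rfl | ⟨h, y, rfl⟩
  · simp [MDP.runMeasure_cyl_singleton]
  · rw [List.concat_eq_append] at *
    rw [List.map_append, List.map_singleton, MDP.runMeasure_cyl_concat]
    change _ * ((mdpFromMEMDP Γ b v).δ (Sum.inl y.1) y.2 (Sum.inr s) * _) = 0
    rw [Γ.mdpFromMEMDP_inl_of_notMem b v (hh y (by simp)) b.support_nonempty.some_mem,
        PMF.map_apply_of_notMem_range _ (by simp)]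
    simp

/-- The payoff of a strategy in the objective `W` under a belief. -/
noncomputable def payoff [Fintype E] (σ : Strat Q A) (b : PMF E) (q : Q) (W : Set (ℕ → Q)) :
    ℝ≥0∞ :=
  ∑ e, b e * (Γ.env e).prob σ q W

theorem _root_.MDP.runMeasure_parity_inter_cyl (G : MDP Q A) (σ : Strat Q A) (q : Q) (c : Q → ℕ)
    (l : List (Q × A)) (y : Q × A) :
    G.runMeasure σ q ({ω | (fun i => (ω i).1) ∈ parityObjective c} ∩ cyl (l ++ [y])) =
      G.runMeasure σ q (cyl (l ++ [y])) *
        ∑ q', G.δ y.1 y.2 q' * G.prob (Strat.after σ (l ++ [y])) q' (parityObjective c) := by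
  have h := G.runMeasure_cyl_inter_shift σ q l y _ (measurableSet_parity_runs c)
  simp only [MDP.prob]
  rw [← h, inter_comm]
  congr 2
  ext ω
  exact (parityObjective_shift c (fun i => (ω i).1) _).symm

/-- After `x` the run is absorbed in a sink, and parity holds almost surely in the winning one
(label 0) and fails almost surely in the losing one (label 1). -/
theorem runMeasure_mdpFromMEMDP_inter_cyl (c : Q → ℕ) (q : Q) (h : List (Q × A)) (x : Q × A)
    (hx : x ∈ Γ.dstg b.support) :
    (mdpFromMEMDP Γ b v).runMeasure τ (Sum.inl q)
        ({ω | (fun i => (ω i).1) ∈ parityObjective (sinkLabel c)} ∩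
          cyl (h.map embPair ++ [embPair x])) =
      (mdpFromMEMDP Γ b v).runMeasure τ (Sum.inl q) (cyl (h.map embPair ++ [embPair x])) *
        Γ.winProb b v x.1 x.2 := by
  classical
  rw [MDP.runMeasure_parity_inter_cyl]
  congr 1
  have h1 : (mdpFromMEMDP Γ b v).δ (embPair x).1 (embPair x).2 =
      sinkPMF Q (Γ.winProb b v x.1 x.2) (Γ.winProb_le_one b v x.1 x.2) :=
    Γ.mdpFromMEMDP_inl_of_mem b v hx
  rw [h1, Fintype.sum_sum_type, Fintype.sum_bool,
    MDP.prob_of_sink _ _ (Sum.inr true) (fun a => rfl),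
    MDP.prob_of_sink _ _ (Sum.inr false) (fun a => rfl)]
  simp [sinkPMF_inl, sinkPMF_inr_true, sinkLabel]

variable [Fintype E]

/-- The history up to `x` is equally likely in all environments of the support, so the belief at `x`
is still `b`. Bayes' rule at the single transition out of `x` then produces the updated beliefs. -/
theorem sum_runMeasure_inter_cyl (hστ : Agree (Γ.dstg b.support) σ τ) (c : Q → ℕ) (q : Q)
    (h : List (Q × A)) (hh : ∀ y ∈ h, y ∉ Γ.dstg b.support) (x : Q × A) :
    ∑ e, b e * (Γ.env e).runMeasure σ q
        ({ω | (fun i => (ω i).1) ∈ parityObjective c} ∩ cyl (h ++ [x])) =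
      (mdpFromMEMDP Γ b v).runMeasure τ (Sum.inl q) (cyl (h.map embPair ++ [embPair x])) *
        ∑ q', Γ.next b x.1 x.2 q' *
          Γ.payoff (Strat.after σ (h ++ [x])) (Γ.update b x.1 x.2 q') q' (parityObjective c) := by
  calc _ = ∑ e, ∑ q', (mdpFromMEMDP Γ b v).runMeasure τ (Sum.inl q)
          (cyl (h.map embPair ++ [embPair x])) * (b e * (Γ.env e).δ x.1 x.2 q' *
            (Γ.env e).prob (Strat.after σ (h ++ [x])) q' (parityObjective c)) := by
        refine Finset.sum_congr rfl fun e _ => ?_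
        by_cases he : e ∈ b.support
        · rw [MDP.runMeasure_parity_inter_cyl, Γ.runMeasure_cyl_eq b v hστ he q h hh x,
            ← Finset.mul_sum]
          simp only [mul_assoc, ← Finset.mul_sum]
          rw [mul_left_comm]
        · rw [(PMF.apply_eq_zero_iff b e).2 he]
          simp
    _ = _ := by
        rw [Finset.sum_comm, Finset.mul_sum]
        refine Finset.sum_congr rfl fun q' _ => ?_
        rw [← Finset.mul_sum]
        congr 1
        rw [payoff, Finset.mul_sum]
        refine Finset.sum_congr rfl fun e _ => ?_
        rw [← mul_assoc, next_mul_update_apply]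

/-- The distribution of the embedded runs under a belief over the environments. -/
noncomputable def mixedMeasure (σ : Strat Q A) (q : Q) : Measure (ℕ → (Q ⊕ Bool) × A) :=
  ∑ e, b e • ((Γ.env e).runMeasure σ q).map fun ω i => embPair (ω i)

theorem measurable_embRun :
    Measurable fun (ω : ℕ → Q × A) i => (embPair (ω i) : (Q ⊕ Bool) × A) :=
  measurable_pi_lambda _ fun i => (measurable_of_countable embPair).comp (measurable_pi_apply i)

theorem mixedMeasure_apply (σ : Strat Q A) (q : Q) {B : Set (ℕ → (Q ⊕ Bool) × A)}
    (hB : MeasurableSet B) :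
    Γ.mixedMeasure b σ q B = ∑ e, b e * (Γ.env e).runMeasure σ q
      ((fun (ω : ℕ → Q × A) i => embPair (ω i)) ⁻¹' B) := by
  simp [mixedMeasure, Measure.map_apply measurable_embRun hB]

theorem _root_.PMF.sum_coe (b : PMF E) : ∑ e, b e = 1 := by
  rw [← tsum_fintype (L := .unconditional _), b.tsum_coe]

instance (σ : Strat Q A) (q : Q) : IsProbabilityMeasure (Γ.mixedMeasure b σ q) :=
  ⟨by rw [mixedMeasure_apply _ _ _ _ MeasurableSet.univ]; simp [b.sum_coe]⟩

theorem mixedMeasure_parity (σ : Strat Q A) (q : Q) (c : Q → ℕ) :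
    Γ.mixedMeasure b σ q {ω | (fun i => (ω i).1) ∈ parityObjective (sinkLabel c)} =
      Γ.payoff σ b q (parityObjective c) := by
  rw [mixedMeasure_apply _ _ _ _ (measurableSet_parity_runs _)]
  rfl

theorem mixedMeasure_cyl_eq (hστ : Agree (Γ.dstg b.support) σ τ) (q : Q)
    (l : List ((Q ⊕ Bool) × A)) (y : (Q ⊕ Bool) × A)
    (hl : ∀ y ∈ l, y ∈ embPair '' (Γ.dstg b.support)ᶜ) :
    Γ.mixedMeasure b σ q (cyl (l ++ [y])) =
      (mdpFromMEMDP Γ b v).runMeasure τ (Sum.inl q) (cyl (l ++ [y])) := by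
  obtain ⟨h, hh, rfl⟩ := exists_map_embPair hl
  rw [mixedMeasure_apply _ _ _ _ (measurableSet_cyl _)]
  rcases y with ⟨q' | s, a⟩
  · have h1 := preimage_embRun_cyl (h ++ [(q', a)])
    rw [List.map_append, List.map_singleton] at h1
    change ∑ e, b e * (Γ.env e).runMeasure σ q (_ ⁻¹' cyl (_ ++ [embPair (q', a)])) = _
    rw [h1]
    change _ = (mdpFromMEMDP Γ b v).runMeasure τ (Sum.inl q)
      (cyl (h.map embPair ++ [embPair (q', a)]))
    rw [← one_mul ((mdpFromMEMDP Γ b v).runMeasure τ (Sum.inl q) _), ← b.sum_coe, Finset.sum_mul]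
    refine Finset.sum_congr rfl fun e _ => ?_
    by_cases he : e ∈ b.support
    · rw [Γ.runMeasure_cyl_eq b v hστ he q h hh]
    · rw [(PMF.apply_eq_zero_iff b e).2 he]
      simp
  · rw [preimage_embRun_cyl_inr, Γ.runMeasure_cyl_inr_eq_zero b v q h hh]
    simp

theorem mixedMeasure_inter_cyl (hστ : Agree (Γ.dstg b.support) σ τ) (c : Q → ℕ) (q : Q)
    (h : List (Q × A)) (hh : ∀ y ∈ h, y ∉ Γ.dstg b.support) (x : Q × A) :
    Γ.mixedMeasure b σ q ({ω | (fun i => (ω i).1) ∈ parityObjective (sinkLabel c)} ∩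
        cyl (h.map embPair ++ [embPair x])) =
      (mdpFromMEMDP Γ b v).runMeasure τ (Sum.inl q) (cyl (h.map embPair ++ [embPair x])) *
        ∑ q', Γ.next b x.1 x.2 q' *
          Γ.payoff (Strat.after σ (h ++ [x])) (Γ.update b x.1 x.2 q') q' (parityObjective c) := by
  rw [mixedMeasure_apply _ _ _ _ ((measurableSet_parity_runs _).inter (measurableSet_cyl _)),
    ← Γ.sum_runMeasure_inter_cyl b v hστ c q h hh]
  have h1 := preimage_embRun_cyl (h ++ [x])
  rw [List.map_append, List.map_singleton] at h1
  simp only [preimage_inter, h1]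
  rfl

theorem payoff_le_prob_add (hστ : Agree (Γ.dstg b.support) σ τ) (c : Q → ℕ) (q : Q) (d : ℝ≥0∞)
    (hd : ∀ h x, (∀ y ∈ h, y ∉ Γ.dstg b.support) → x ∈ Γ.dstg b.support →
      ∑ q', Γ.next b x.1 x.2 q' * Γ.payoff (Strat.after σ (h ++ [x])) (Γ.update b x.1 x.2 q') q'
        (parityObjective c) ≤ Γ.winProb b v x.1 x.2 + d) :
    Γ.payoff σ b q (parityObjective c) ≤
      (mdpFromMEMDP Γ b v).prob τ (Sum.inl q) (parityObjective (sinkLabel c)) + d := by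
  rw [← mixedMeasure_parity]
  refine measure_le_of_exitWords (K := embPair '' (Γ.dstg b.support)ᶜ)
    (fun l y hl => Γ.mixedMeasure_cyl_eq b v hστ q l y hl) (measurableSet_parity_runs _) d ?_
  intro p hp
  obtain ⟨h, hh, ⟨x, hx, rfl⟩ | ⟨s, a, rfl⟩⟩ := exitWords_image_cases hp
  · rw [Γ.mixedMeasure_inter_cyl b v hστ c q h hh, Γ.runMeasure_mdpFromMEMDP_inter_cyl b v c q h x hx,
      ← mul_add]
    gcongr
    exact hd h x hh hx
  · refine (measure_mono inter_subset_right).trans ?_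
    rw [Γ.mixedMeasure_cyl_eq b v hστ q _ _ hp.1, Γ.runMeasure_cyl_inr_eq_zero b v q h hh]
    exact zero_le

theorem prob_le_payoff_add (hστ : Agree (Γ.dstg b.support) σ τ) (c : Q → ℕ) (q : Q) (d : ℝ≥0∞)
    (hd : ∀ h x, (∀ y ∈ h, y ∉ Γ.dstg b.support) → x ∈ Γ.dstg b.support →
      Γ.winProb b v x.1 x.2 ≤ ∑ q', Γ.next b x.1 x.2 q' *
        Γ.payoff (Strat.after σ (h ++ [x])) (Γ.update b x.1 x.2 q') q' (parityObjective c) + d) :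
    (mdpFromMEMDP Γ b v).prob τ (Sum.inl q) (parityObjective (sinkLabel c)) ≤
      Γ.payoff σ b q (parityObjective c) + d := by
  rw [← mixedMeasure_parity]
  refine measure_le_of_exitWords (K := embPair '' (Γ.dstg b.support)ᶜ)
    (fun l y hl => (Γ.mixedMeasure_cyl_eq b v hστ q l y hl).symm) (measurableSet_parity_runs _) d ?_
  intro p hp
  obtain ⟨h, hh, ⟨x, hx, rfl⟩ | ⟨s, a, rfl⟩⟩ := exitWords_image_cases hp
  · rw [Γ.mixedMeasure_cyl_eq b v hστ q _ _ hp.1, Γ.mixedMeasure_inter_cyl b v hστ c q h hh,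
      Γ.runMeasure_mdpFromMEMDP_inter_cyl b v c q h x hx, ← mul_add]
    gcongr
    exact hd h x hh hx
  · refine (measure_mono inter_subset_right).trans ?_
    rw [Γ.runMeasure_cyl_inr_eq_zero b v q h hh]
    exact zero_le

theorem payoff_le_priorValue (σ : Strat Q A) (q : Q) (W : Set (ℕ → Q)) :
    Γ.payoff σ b q W ≤ Γ.priorValue b q W :=
  le_iSup (fun σ => Γ.payoff σ b q W) σ

theorem payoff_le_one (σ : Strat Q A) (q : Q) (W : Set (ℕ → Q)) : Γ.payoff σ b q W ≤ 1 := by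
  rw [← b.sum_coe]
  exact Finset.sum_le_sum fun e _ => mul_le_of_le_one_right' (MDP.prob_le_one _ _ _ _)

theorem priorValue_le_one (q : Q) (W : Set (ℕ → Q)) : Γ.priorValue b q W ≤ 1 :=
  iSup_le fun σ => Γ.payoff_le_one b σ q W

theorem exists_priorValue_le_payoff_add [Nonempty A] (q : Q) (W : Set (ℕ → Q)) {d : ℝ≥0∞} (hd : d ≠ 0) :
    ∃ σ, Γ.priorValue b q W ≤ Γ.payoff σ b q W + d := by
  by_contra! hc
  have h1 : Γ.priorValue b q W ≤ Γ.priorValue b q W - d :=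
    iSup_le fun σ => ENNReal.le_sub_of_add_le_right
      (ne_top_of_lt (lt_of_le_of_lt le_add_self (hc σ))) (hc σ).le
  have h2 : Γ.priorValue b q W ≠ 0 :=
    (lt_of_le_of_lt zero_le (hc fun _ _ => PMF.pure (Classical.arbitrary A))).ne'
  exact absurd h1 (not_le.2 (ENNReal.sub_lt_self
    (ne_top_of_le_ne_top ENNReal.one_ne_top (Γ.priorValue_le_one b q W)) h2 hd))

/-- The prior value is at most the value of the MDP built from estimates of the prior values after
a distinguishing pair, up to the error of these estimates. -/
theorem priorValue_le_value_add (c : Q → ℕ) (q : Q) (d : ℝ≥0∞)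
    (hd : ∀ x ∈ Γ.dstg b.support,
      ∑ q', Γ.next b x.1 x.2 q' * Γ.priorValue (Γ.update b x.1 x.2 q') q' (parityObjective c) ≤
        Γ.winProb b v x.1 x.2 + d) :
    Γ.priorValue b q (parityObjective c) ≤
      (mdpFromMEMDP Γ b v).value (Sum.inl q) (parityObjective (sinkLabel c)) + d := by
  refine iSup_le fun σ => ?_
  -- What `τ` plays once a sink has been reached does not matter, so sinks are read as an arbitrary
  -- state.
  let r : Q ⊕ Bool → Q := Sum.elim id fun _ => q
  let τ : Strat (Q ⊕ Bool) A := fun l s => σ (l.map fun x => (r x.1, x.2)) (r s)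
  have hστ : Agree (Γ.dstg b.support) σ τ := by
    intro h _ q
    simp only [τ, List.map_map]
    congr 1
    exact List.map_id _
  refine (Γ.payoff_le_prob_add b v hστ c q d fun h x _ hx => ?_).trans
    (add_le_add_left (le_iSup (fun τ => (mdpFromMEMDP Γ b v).prob τ _ _) τ) d)
  refine le_trans ?_ (hd x hx)
  gcongr
  exact payoff_le_priorValue _ _ _ _ _

/-- The continuation reads the state after `x` off the history, so it differs from `opt x q` only on
histories that do not start in `q`, which are null. -/
theorem prob_switchStrat_after (G : MDP Q A) {D : Set (Q × A)} (τ : Strat (Q ⊕ Bool) A)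
    (opt : Q × A → Q → Strat Q A) {h : List (Q × A)} (hh : ∀ y ∈ h, y ∉ D) {x : Q × A}
    (hx : x ∈ D) (q : Q) (W : Set (ℕ → Q)) :
    G.prob (Strat.after (switchStrat D τ opt) (h ++ [x])) q W = G.prob (opt x q) q W := by
  have : G.runMeasure (Strat.after (switchStrat D τ opt) (h ++ [x])) q =
      G.runMeasure (opt x q) q := by
    refine MDP.runMeasure_congr _ _ _ _ ?_ fun y l q' hy => ?_
    · exact switchStrat_after τ opt hh hx [] q
    · rw [switchStrat_after τ opt hh hx, List.map_cons, List.headD_cons, hy]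
  rw [MDP.prob, MDP.prob, this]

/-- The value of the MDP built from estimates of the prior values after a distinguishing pair is at
most the prior value, up to the error of these estimates. -/
theorem value_le_priorValue_add [Nonempty A] (c : Q → ℕ) (q : Q) (d : ℝ≥0∞)
    (hd : ∀ x ∈ Γ.dstg b.support, Γ.winProb b v x.1 x.2 ≤
      ∑ q', Γ.next b x.1 x.2 q' * Γ.priorValue (Γ.update b x.1 x.2 q') q' (parityObjective c) +
        d) :
    (mdpFromMEMDP Γ b v).value (Sum.inl q) (parityObjective (sinkLabel c)) ≤
      Γ.priorValue b q (parityObjective c) + d := by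
  -- Optimal continuations need not exist; the slack `r` leaves room for near-optimal ones.
  refine iSup_le fun τ => ENNReal.le_of_forall_pos_le_add fun r hr _ => ?_
  have hr' : (r : ℝ≥0∞) ≠ 0 := by exact_mod_cast hr.ne'
  choose opt hopt using fun (x : Q × A) q' => Γ.exists_priorValue_le_payoff_add
    (Γ.update b x.1 x.2 q') q' (parityObjective c) hr'
  have hστ := agree_switchStrat (Γ.dstg b.support) τ opt
  rw [add_assoc]
  refine (Γ.prob_le_payoff_add b v hστ c q (d + r) fun h x hh hx => ?_).trans
    (add_le_add_left (Γ.payoff_le_priorValue b _ _ _) _)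
  have hpay : ∀ q', Γ.payoff (Strat.after (switchStrat (Γ.dstg b.support) τ opt) (h ++ [x]))
      (Γ.update b x.1 x.2 q') q' (parityObjective c) =
      Γ.payoff (opt x q') (Γ.update b x.1 x.2 q') q' (parityObjective c) := fun q' =>
    Finset.sum_congr rfl fun e _ =>
      congrArg _ (prob_switchStrat_after (Γ.env e) τ opt hh hx q' (parityObjective c))
  rw [Finset.sum_congr rfl fun q' _ => congrArg (Γ.next b x.1 x.2 q' * ·) (hpay q')]
  refine (hd x hx).trans ?_
  rw [add_comm d, ← add_assoc]
  refine add_le_add_left ?_ d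
  calc ∑ q', Γ.next b x.1 x.2 q' * Γ.priorValue (Γ.update b x.1 x.2 q') q' (parityObjective c)
      ≤ ∑ q', (Γ.next b x.1 x.2 q' *
          Γ.payoff (opt x q') (Γ.update b x.1 x.2 q') q' (parityObjective c) +
          Γ.next b x.1 x.2 q' * r) := by
        refine Finset.sum_le_sum fun q' _ => ?_
        rw [← mul_add]
        exact mul_le_mul_right (hopt x q') _
    _ = _ := by
      rw [Finset.sum_add_distrib, ← Finset.sum_mul, PMF.sum_coe, one_mul]

end MEMDP

/-! ### The Bhattacharyya coefficient of distinguished environments -/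

/-- Expanding squares gives ∑(√p − √p')² = 2 − 2∑√(pp'). Equal total mass forces two distinct
distributions to differ in at least two points, so the left side is at least 2θ and the factors 2
cancel. -/
theorem sum_sqrt_mul_le {Q : Type*} [Fintype Q] {p p' : Q → ℝ} (hp : ∀ q, 0 ≤ p q)
    (hp' : ∀ q, 0 ≤ p' q) (hs : ∑ q, p q = 1) (hs' : ∑ q, p' q = 1) (hne : p ≠ p') {θ : ℝ}
    (hθ : ∀ q, p q ≠ p' q → θ ≤ (√(p q) - √(p' q)) ^ 2) :
    ∑ q, √(p q * p' q) ≤ 1 - θ := by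
  classical
  obtain ⟨q₁, h₁⟩ := Function.ne_iff.1 hne
  obtain ⟨q₂, h₂, h₂₁⟩ : ∃ q₂, p q₂ ≠ p' q₂ ∧ q₁ ≠ q₂ := by
    by_contra! hc
    apply h₁
    have : ∑ q ∈ Finset.univ.erase q₁, p q = ∑ q ∈ Finset.univ.erase q₁, p' q :=
      Finset.sum_congr rfl fun q hq => by
        by_contra h
        exact Finset.ne_of_mem_erase hq (hc q h).symm
    have e1 := Finset.add_sum_erase Finset.univ p (Finset.mem_univ q₁)
    have e2 := Finset.add_sum_erase Finset.univ p' (Finset.mem_univ q₁)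
    linarith
  have h1 : 2 * θ ≤ ∑ q, (√(p q) - √(p' q)) ^ 2 := by
    calc 2 * θ ≤ ∑ q ∈ {q₁, q₂}, (√(p q) - √(p' q)) ^ 2 := by
          rw [Finset.sum_pair h₂₁]
          linarith [hθ q₁ h₁, hθ q₂ h₂]
      _ ≤ _ := Finset.sum_le_sum_of_subset_of_nonneg (Finset.subset_univ _)
          fun q _ _ => sq_nonneg _
  have h2 : ∑ q, (√(p q) - √(p' q)) ^ 2 = 2 - 2 * ∑ q, √(p q * p' q) := by
    calc ∑ q, (√(p q) - √(p' q)) ^ 2 = ∑ q, (p q + p' q - 2 * √(p q * p' q)) := by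
          refine Finset.sum_congr rfl fun q _ => ?_
          rw [sub_sq, Real.sq_sqrt (hp q), Real.sq_sqrt (hp' q), Real.sqrt_mul (hp q)]
          ring
      _ = _ := by
          rw [Finset.sum_sub_distrib, Finset.sum_add_distrib, hs, hs', ← Finset.mul_sum]
          ring
  linarith

namespace MEMDP

variable {Q A E : Type*} (Γ : MEMDP Q A E)

theorem toReal_le_one (e : E) (q : Q) (a : A) (q' : Q) : ((Γ.env e).δ q a q').toReal ≤ 1 :=
  ENNReal.toReal_le_of_le_ofReal zero_le_one (by simpa using PMF.coe_le_one _ _)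

theorem exists_pos_prob [Nonempty Q] [Nonempty A] [Nonempty E] :
    ∃ e q a q', 0 < ((Γ.env e).δ q a q').toReal := by
  inhabit Q; inhabit A; inhabit E
  obtain ⟨q', h⟩ := ((Γ.env default).δ default default).support_nonempty
  exact ⟨default, default, default, q', ENNReal.toReal_pos h (PMF.apply_ne_top _ _)⟩

theorem iota_nonneg : 0 ≤ Γ.iota := le_min (sq_nonneg _) zero_le_one

theorem iota_le_one : Γ.iota ≤ 1 := min_le_right _ _

variable [Finite Q] [Finite A] [Finite E]

theorem finite_positive_probs :
    {x : ℝ | ∃ e q a q', x = ((Γ.env e).δ q a q').toReal ∧ 0 < x}.Finite := by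
  refine (Set.finite_range fun y : E × Q × A × Q =>
    ((Γ.env y.1).δ y.2.1 y.2.2.1 y.2.2.2).toReal).subset ?_
  rintro _ ⟨e, q, a, q', rfl, -⟩
  exact ⟨(e, q, a, q'), rfl⟩

theorem finite_ratios : Γ.ratios.Finite := by
  refine (Set.finite_range fun y : E × E × Q × A × Q =>
    ((Γ.env y.1).δ y.2.2.1 y.2.2.2.1 y.2.2.2.2).toReal /
      ((Γ.env y.2.1).δ y.2.2.1 y.2.2.2.1 y.2.2.2.2).toReal).subset ?_
  rintro _ ⟨e, e', q, a, q', -, -, rfl⟩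
  exact ⟨(e, e', q, a, q'), rfl⟩

theorem pMin_le {e : E} {q : Q} {a : A} {q' : Q} (h : 0 < ((Γ.env e).δ q a q').toReal) :
    Γ.pMin ≤ ((Γ.env e).δ q a q').toReal :=
  csInf_le Γ.finite_positive_probs.bddBelow ⟨e, q, a, q', rfl, h⟩

theorem pMin_pos [Nonempty Q] [Nonempty A] [Nonempty E] : 0 < Γ.pMin := by
  obtain ⟨e, q, a, q', h⟩ := Γ.exists_pos_prob
  obtain ⟨_, _, _, _, _, h⟩ := Set.Nonempty.csInf_mem (s := {x : ℝ | ∃ e q a q',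
    x = ((Γ.env e).δ q a q').toReal ∧ 0 < x}) ⟨_, e, q, a, q', rfl, h⟩ Γ.finite_positive_probs
  exact h

theorem pMin_le_one [Nonempty Q] [Nonempty A] [Nonempty E] : Γ.pMin ≤ 1 := by
  obtain ⟨e, q, a, q', h⟩ := Γ.exists_pos_prob
  exact (Γ.pMin_le h).trans (Γ.toReal_le_one _ _ _ _)

theorem one_le_ratioMax [Nonempty Q] [Nonempty A] [Nonempty E] : 1 ≤ Γ.ratioMax := by
  obtain ⟨e, q, a, q', h⟩ := Γ.exists_pos_prob
  exact le_csSup Γ.finite_ratios.bddAbove ⟨e, e, q, a, q', h, h, (div_self h.ne').symm⟩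

theorem finite_ratios_gt_one : {x ∈ Γ.ratios | 1 < x}.Finite :=
  Γ.finite_ratios.subset (sep_subset _ _)

theorem ratioGtOne_le {r : ℝ} (hr : r ∈ Γ.ratios) (h : 1 < r) : Γ.ratioGtOne ≤ r := by
  rw [ratioGtOne, if_pos ⟨r, hr, h⟩]
  exact csInf_le Γ.finite_ratios_gt_one.bddBelow ⟨hr, h⟩

theorem one_lt_ratioGtOne {r : ℝ} (hr : r ∈ Γ.ratios) (h : 1 < r) : 1 < Γ.ratioGtOne := by
  rw [ratioGtOne, if_pos ⟨r, hr, h⟩]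
  exact (Set.Nonempty.csInf_mem (s := {x ∈ Γ.ratios | 1 < x}) ⟨r, hr, h⟩ Γ.finite_ratios_gt_one).2

/-- If one of the two probabilities is zero, the squared difference is the other one, hence at least
p_min. By symmetry only the case of `hr` remains. -/
theorem le_sq_sqrt_sub_sqrt {e e' : E} {q : Q} {a : A} {q' : Q} {θ : ℝ} (hθ : θ ≤ Γ.pMin)
    (hr : ∀ e e', 0 < ((Γ.env e').δ q a q').toReal →
      ((Γ.env e').δ q a q').toReal < ((Γ.env e).δ q a q').toReal →
      θ ≤ (√((Γ.env e).δ q a q').toReal - √((Γ.env e').δ q a q').toReal) ^ 2)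
    (hne : ((Γ.env e).δ q a q').toReal ≠ ((Γ.env e').δ q a q').toReal) :
    θ ≤ (√((Γ.env e).δ q a q').toReal - √((Γ.env e').δ q a q').toReal) ^ 2 := by
  wlog h : ((Γ.env e').δ q a q').toReal < ((Γ.env e).δ q a q').toReal generalizing e e'
  · rw [← neg_sub, neg_sq]
    exact this hne.symm (lt_of_le_of_ne (not_lt.1 h) hne)
  rcases (ENNReal.toReal_nonneg (a := (Γ.env e').δ q a q')).eq_or_lt with h0 | h0
  · rw [← h0] at h ⊢
    rw [Real.sqrt_zero, sub_zero, Real.sq_sqrt h.le]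
    exact hθ.trans (Γ.pMin_le h)
  · exact hr e e' h0 h

theorem pMin_mul_iota_le [Nonempty Q] [Nonempty A] [Nonempty E] {e e' : E} {q : Q} {a : A} {q' : Q}
    (hne : ((Γ.env e).δ q a q').toReal ≠ ((Γ.env e').δ q a q').toReal) :
    Γ.pMin * Γ.iota ≤ (√((Γ.env e).δ q a q').toReal - √((Γ.env e').δ q a q').toReal) ^ 2 := by
  refine Γ.le_sq_sqrt_sub_sqrt (mul_le_of_le_one_right Γ.pMin_pos.le Γ.iota_le_one) ?_ hne
  intro e e' h0 h
  set x := ((Γ.env e).δ q a q').toReal with hx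
  set y := ((Γ.env e').δ q a q').toReal with hy
  have hr : x / y ∈ Γ.ratios := ⟨e, e', q, a, q', h0.trans h, h0, rfl⟩
  have hr1 : 1 < x / y := (one_lt_div h0).2 h
  -- This factorization separates the two constants: y ≥ p_min, and x/y is a ratio above 1, hence at
  -- least r^{>1}.
  have e1 : √x - √y = √y * (√(x / y) - 1) := by
    rw [mul_sub, mul_one, ← Real.sqrt_mul h0.le, mul_div_cancel₀ _ h0.ne']
  rw [e1, mul_pow, Real.sq_sqrt h0.le]
  refine mul_le_mul (Γ.pMin_le h0) ?_ Γ.iota_nonneg h0.le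
  refine (min_le_left _ _).trans ?_
  have h2 : 1 ≤ √Γ.ratioGtOne := Real.one_le_sqrt.2 (Γ.one_lt_ratioGtOne hr hr1).le
  exact pow_le_pow_left₀ (by linarith)
    (sub_le_sub_right (Real.sqrt_le_sqrt (Γ.ratioGtOne_le hr hr1)) _) 2

theorem pMin_le_of_ratioGtOne {e e' : E} {q : Q} {a : A} {q' : Q} (h1 : Γ.ratioGtOne ≤ 1)
    (hne : ((Γ.env e).δ q a q').toReal ≠ ((Γ.env e').δ q a q').toReal) :
    Γ.pMin ≤ (√((Γ.env e).δ q a q').toReal - √((Γ.env e').δ q a q').toReal) ^ 2 := by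
  refine Γ.le_sq_sqrt_sub_sqrt le_rfl ?_ hne
  intro e e' h0 h
  have hr : _ ∈ Γ.ratios := ⟨e, e', q, a, q', h0.trans h, h0, rfl⟩
  exact absurd (Γ.one_lt_ratioGtOne hr ((one_lt_div h0).2 h)) (not_lt.2 h1)

end MEMDP

/-! ### The decay guaranteed by n₁ and n₃ -/

theorem pow_le_of_mul_logb_le {β κ : ℝ} (hβ : 0 < β) (hκ : 0 < κ) {n : ℕ}
    (h : n * Real.logb 2 β ≤ Real.logb 2 κ) : β ^ n ≤ κ := by
  rw [← Real.logb_le_logb (b := 2) (by norm_num) (by positivity) hκ, Real.logb_pow]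
  exact h

namespace MEMDP

theorem one_le_n₁ {Q A E : Type*} [Fintype E] (Γ : MEMDP Q A E) (κ : ℝ) : 1 ≤ Γ.n₁ κ :=
  le_max_left _ _

variable {Q A E : Type*} [Fintype Q] [Fintype A] [Fintype E] (Γ : MEMDP Q A E)

theorem one_sub_pMin_pow_n₁_le [Nonempty Q] [Nonempty A] [Nonempty E] {κ : ℝ} (hκ : 0 < κ) :
    (1 - Γ.pMin) ^ Γ.n₁ κ ≤ κ := by
  -- For p_min = 1 the base is 0, and the lower bound 1 on n₁ is what makes the power vanish.
  rcases Γ.pMin_le_one.eq_or_lt with h1 | h1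
  · rw [h1, sub_self, zero_pow (Nat.one_le_iff_ne_zero.1 (Γ.one_le_n₁ κ))]
    exact hκ.le
  have hlog : Real.logb 2 (1 - Γ.pMin) < 0 :=
    Real.logb_neg (by norm_num) (by linarith) (by linarith [Γ.pMin_pos])
  have hE : (1 : ℝ) ≤ Fintype.card E := by exact_mod_cast Fintype.card_pos
  have hκE : κ / (2 * Fintype.card E) ≤ κ := div_le_self hκ.le (by linarith)
  refine (pow_le_of_mul_logb_le (κ := κ / (2 * Fintype.card E)) (by linarith) (by positivity)
    ?_).trans hκE
  rw [← div_le_iff_of_neg hlog]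
  refine (Nat.le_ceil _).trans ?_
  exact Nat.cast_le.2 (le_max_right _ _)

theorem pow_n₃_le [Nonempty Q] [Nonempty A] [Nonempty E] {κ : ℝ} (hκ : 0 < κ)
    (hη : Γ.eta ≠ 0) (h0 : 0 < 1 - Γ.pMin * Γ.iota) :
    (1 - Γ.pMin * Γ.iota) ^ Γ.n₃ κ ≤ κ := by
  have h1 : 1 - Γ.pMin * Γ.iota ≤ 1 := by linarith [mul_nonneg Γ.pMin_pos.le Γ.iota_nonneg]
  have hη' : Γ.eta < 0 :=
    lt_of_le_of_ne (Real.logb_nonpos (by norm_num) h0.le h1) hη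
  refine pow_le_of_mul_logb_le h0 hκ ?_
  change Γ.n₃ κ * Γ.eta ≤ _
  have h2 : 2 * |Real.logb 2 κ| ≤ Γ.n₂ κ := by
    refine le_trans ?_ (Nat.le_ceil _)
    have : 0 ≤ Real.logb 2 Γ.ratioMax := Real.logb_nonneg (by norm_num) Γ.one_le_ratioMax
    have := mul_nonneg (Nat.cast_nonneg (α := ℝ) (Γ.n₁ κ)) this
    linarith
  -- The second summand of n₃ already suffices: with n₂ ≥ 2|log κ| it gives n₃|η| ≥ 4|log κ|.
  have h3 : 2 * (Γ.n₂ κ : ℝ) / |Γ.eta| ≤ Γ.n₃ κ := by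
    rw [n₃, if_neg hη]
    refine le_trans ?_ (Nat.le_ceil _)
    refine le_add_of_nonneg_left ?_
    positivity
  rw [abs_of_neg hη', div_le_iff₀ (by linarith)] at h3
  have h4 := neg_abs_le (Real.logb 2 κ)
  have h5 := abs_nonneg (Real.logb 2 κ)
  linarith

/-- The Bhattacharyya coefficient of two environments in a pair that distinguishes them is bounded
away from `1`, in terms of the numbers `n₁` and `n₃`. -/
theorem exists_affinity_bound [Nonempty Q] [Nonempty A] [Nonempty E] {κ : ℝ} (hκ : 0 < κ) :
    ∃ β : ℝ, 0 ≤ β ∧ β ≤ 1 ∧ β ^ (Γ.n₁ κ + Γ.n₃ κ) ≤ κ ∧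
      ∀ e e' q a, (Γ.env e).δ q a ≠ (Γ.env e').δ q a →
        ∑ q', √(((Γ.env e).δ q a q').toReal * ((Γ.env e').δ q a q').toReal) ≤ β := by
  have hp0 := Γ.pMin_pos
  have hp1 := Γ.pMin_le_one
  have hi0 := Γ.iota_nonneg
  have hpi : Γ.pMin * Γ.iota ≤ 1 := mul_le_one₀ hp1 hi0 Γ.iota_le_one
  have hpi0 : 0 ≤ Γ.pMin * Γ.iota := mul_nonneg hp0.le hi0
  have key : ∀ θ : ℝ, (∀ e e' q a q', ((Γ.env e).δ q a q').toReal ≠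
      ((Γ.env e').δ q a q').toReal →
      θ ≤ (√((Γ.env e).δ q a q').toReal - √((Γ.env e').δ q a q').toReal) ^ 2) →
      ∀ e e' q a, (Γ.env e).δ q a ≠ (Γ.env e').δ q a →
        ∑ q', √(((Γ.env e).δ q a q').toReal * ((Γ.env e').δ q a q').toReal) ≤ 1 - θ := by
    intro θ hθ e e' q a hne
    have hsum : ∀ e, ∑ q', ((Γ.env e).δ q a q').toReal = 1 := by
      intro e
      rw [← ENNReal.toReal_sum fun q' _ => PMF.apply_ne_top _ _,
        ← tsum_fintype (L := .unconditional _), PMF.tsum_coe, ENNReal.toReal_one]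
    refine sum_sqrt_mul_le (fun _ => ENNReal.toReal_nonneg) (fun _ => ENNReal.toReal_nonneg)
      (hsum e) (hsum e') (fun h => hne (PMF.ext fun q' => ?_)) fun q' h => hθ e e' q a q' h
    exact (ENNReal.toReal_eq_toReal_iff' (PMF.apply_ne_top _ _) (PMF.apply_ne_top _ _)).1
      (congrFun h q')
  -- η = 0 has two causes: ι = 0, when no ratio exceeds 1, and p_min ι = 1, since `Real.logb 2 0 =
  -- 0`. In the second case the coefficients are 0, and n₁ ≥ 1 is enough.
  by_cases hη : Γ.eta = 0
  · rw [eta, Real.logb_eq_zero] at hη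
    by_cases hone : 1 - Γ.pMin * Γ.iota = 1
    · have hι : Γ.iota = 0 := by
        have : Γ.pMin * Γ.iota = 0 := by linarith
        exact (mul_eq_zero.1 this).resolve_left hp0.ne'
      have hr : Γ.ratioGtOne ≤ 1 := by
        rw [iota] at hι
        rcases min_choice ((√Γ.ratioGtOne - 1) ^ 2) 1 with h | h
        · rw [h] at hι
          have := pow_eq_zero_iff (two_ne_zero) |>.1 hι
          exact (Real.sqrt_eq_one.1 (by linarith)).le
        · rw [h] at hι
          norm_num at hι
      refine ⟨1 - Γ.pMin, by linarith, by linarith, ?_,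
        key _ fun e e' q a q' h => Γ.pMin_le_of_ratioGtOne hr h⟩
      exact (pow_le_pow_of_le_one (by linarith) (by linarith) (Nat.le_add_right _ _)).trans
        (Γ.one_sub_pMin_pow_n₁_le hκ)
    · have hzero : 1 - Γ.pMin * Γ.iota = 0 := by
        rcases hη with h | h | h | h | h | h
        · norm_num at h
        · norm_num at h
        · norm_num at h
        · exact h
        · exact absurd h hone
        · linarith
      refine ⟨0, le_rfl, zero_le_one, ?_, hzero ▸ key _ fun e e' q a q' h => Γ.pMin_mul_iota_le h⟩
      have := Γ.one_le_n₁ κ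
      rw [zero_pow (by omega)]
      exact hκ.le
  · have hne : 1 - Γ.pMin * Γ.iota ≠ 0 := fun h => hη (by rw [eta, h, Real.logb_zero])
    refine ⟨1 - Γ.pMin * Γ.iota, by linarith, by linarith, ?_,
      key _ fun e e' q a q' h => Γ.pMin_mul_iota_le h⟩
    exact (pow_le_pow_of_le_one (by linarith) (by linarith) (Nat.le_add_left _ _)).trans
      (Γ.pow_n₃_le hκ hη (lt_of_le_of_ne (by linarith) hne.symm))

end MEMDP

/-! ### The geometric mean of a belief -/

/-- Hölder's inequality with all exponents 1/|S|, after replacing both `f e₁` and `f e₂` by their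
geometric mean. The product is unchanged, but two of the factors now sum to at most `B` each. -/
theorem ENNReal.sum_prod_rpow_le {Q E : Type*} [Fintype Q] [Fintype E] (f : E → Q → ℝ≥0∞)
    (hf : ∀ e, ∑ q, f e q ≤ 1) {S : Finset E} {e₁ e₂ : E} (h₁ : e₁ ∈ S) (h₂ : e₂ ∈ S)
    (hne : e₁ ≠ e₂) {B : ℝ≥0∞} (hB : ∑ q, (f e₁ q * f e₂ q) ^ (1 / 2 : ℝ) ≤ B) :
    ∑ q, ∏ e ∈ S, f e q ^ (1 / S.card : ℝ) ≤ B ^ (2 / S.card : ℝ) := by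
  classical
  have hS : (S.card : ℝ) ≠ 0 := by exact_mod_cast (Finset.card_pos.2 ⟨e₁, h₁⟩).ne'
  have hS0 : (0 : ℝ) ≤ 1 / S.card := by positivity
  -- The family with the two distinguished members averaged geometrically.
  let z : E → Q → ℝ≥0∞ := fun e q =>
    if e = e₁ ∨ e = e₂ then (f e₁ q * f e₂ q) ^ (1 / 2 : ℝ) else f e q
  have h₂' : e₂ ∈ S.erase e₁ := Finset.mem_erase.2 ⟨hne.symm, h₂⟩
  have split : ∀ g : E → ℝ≥0∞, ∏ e ∈ S, g e = g e₁ * g e₂ * ∏ e ∈ (S.erase e₁).erase e₂, g e := by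
    intro g
    rw [← Finset.mul_prod_erase S g h₁, ← Finset.mul_prod_erase _ g h₂', mul_assoc]
  have hz : ∀ e ∈ (S.erase e₁).erase e₂, ∀ q, z e q = f e q := by
    intro e he q
    simp only [Finset.mem_erase] at he
    simp [z, he.1, he.2.1]
  have hfz : ∀ q, ∏ e ∈ S, f e q ^ (1 / S.card : ℝ) = ∏ e ∈ S, z e q ^ (1 / S.card : ℝ) := by
    intro q
    rw [split, split]
    congr 1
    · simp only [z, true_or, or_true, if_true]
      rw [← ENNReal.rpow_mul, ← ENNReal.rpow_add_of_nonneg _ _ (by positivity) (by positivity),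
        ← ENNReal.mul_rpow_of_nonneg _ _ hS0]
      congr 1
      ring
    · exact Finset.prod_congr rfl fun e he => by rw [hz e he]
  let _ : MeasurableSpace Q := ⊤
  have hold := ENNReal.lintegral_prod_norm_pow_le (μ := Measure.count) S (f := z)
    (fun e _ => (measurable_from_top).aemeasurable) (p := fun _ => (1 / S.card : ℝ))
    (by simp [hS]) (fun _ _ => hS0)
  simp only [lintegral_count, tsum_fintype] at hold
  simp only [hfz]
  refine hold.trans ?_
  rw [split]
  have hrest : ∏ e ∈ (S.erase e₁).erase e₂, (∑ q, z e q) ^ (1 / S.card : ℝ) ≤ 1 := by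
    refine Finset.prod_le_one' fun e he => ?_
    rw [Finset.sum_congr rfl fun q _ => hz e he q]
    exact ENNReal.rpow_le_one (hf e) hS0
  refine (mul_le_of_le_one_right' hrest).trans ?_
  simp only [z, true_or, or_true, if_true]
  rw [← ENNReal.rpow_add_of_nonneg _ _ hS0 hS0]
  refine (ENNReal.rpow_le_rpow hB (add_nonneg hS0 hS0)).trans_eq ?_
  congr 1
  ring

/-- The geometric mean of a belief on a set of environments. -/
noncomputable def geoMean {E : Type*} (S : Finset E) (b : PMF E) : ℝ≥0∞ :=
  ∏ e ∈ S, b e ^ (1 / S.card : ℝ)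

theorem geoMean_le_one {E : Type*} (S : Finset E) (b : PMF E) : geoMean S b ≤ 1 :=
  Finset.prod_le_one' fun e _ => ENNReal.rpow_le_one (b.coe_le_one e) (by positivity)

theorem prod_rpow_const {E : Type*} {S : Finset E} (hS : S.Nonempty) (x : ℝ≥0∞) :
    ∏ _e ∈ S, x ^ (1 / S.card : ℝ) = x := by
  have : (S.card : ℝ) ≠ 0 := by exact_mod_cast hS.card_pos.ne'
  rw [Finset.prod_const, ← ENNReal.rpow_natCast, ← ENNReal.rpow_mul, one_div,
    inv_mul_cancel₀ this, ENNReal.rpow_one]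

theorem le_geoMean {E : Type*} {S : Finset E} (hS : S.Nonempty) (b : PMF E) {x : ℝ≥0∞}
    (h : ∀ e ∈ S, x ≤ b e) : x ≤ geoMean S b := by
  conv_lhs => rw [← prod_rpow_const hS x]
  exact Finset.prod_le_prod' fun e he => ENNReal.rpow_le_rpow (h e he) (by positivity)

/-- The geometric mean is homogeneous of degree 1, so the normalizing factor of Bayes' rule cancels
against the probability of the next state. What remains is `geoMean S b` times a sum to which
Hölder's inequality applies. -/
theorem MEMDP.sum_next_mul_geoMean_le {Q A E : Type*} [Fintype Q] [Fintype E] (Γ : MEMDP Q A E)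
    (b : PMF E) {S : Finset E} {q : Q} {a : A} (hqa : (q, a) ∈ Γ.dstg S) {β : ℝ}
    (hβ : ∀ e e', (Γ.env e).δ q a ≠ (Γ.env e').δ q a →
      ∑ q', √(((Γ.env e).δ q a q').toReal * ((Γ.env e').δ q a q').toReal) ≤ β)
    (hup : ∀ q' e, Γ.next b q a q' * Γ.update b q a q' e = b e * (Γ.env e).δ q a q') :
    ∑ q', Γ.next b q a q' * geoMean S (Γ.update b q a q') ≤
      ENNReal.ofReal β ^ (2 / S.card : ℝ) * geoMean S b := by
  obtain ⟨e₁, h₁, e₂, h₂, hne⟩ := hqa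
  have hS : S.Nonempty := ⟨e₁, h₁⟩
  have hS0 : (0 : ℝ) ≤ 1 / S.card := by positivity
  have h1 : ∀ q', Γ.next b q a q' * geoMean S (Γ.update b q a q') =
      geoMean S b * ∏ e ∈ S, (Γ.env e).δ q a q' ^ (1 / S.card : ℝ) := by
    intro q'
    conv_lhs => rw [← prod_rpow_const hS (Γ.next b q a q')]
    rw [geoMean, geoMean, ← Finset.prod_mul_distrib, ← Finset.prod_mul_distrib]
    refine Finset.prod_congr rfl fun e _ => ?_
    rw [← ENNReal.mul_rpow_of_nonneg _ _ hS0, ← ENNReal.mul_rpow_of_nonneg _ _ hS0, hup]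
  simp only [h1, ← Finset.mul_sum]
  rw [mul_comm]
  gcongr
  refine ENNReal.sum_prod_rpow_le (fun e q' => (Γ.env e).δ q a q') (fun e => ?_) h₁ h₂
    (fun h => hne (by rw [h])) ?_
  · rw [← tsum_fintype (L := .unconditional _), PMF.tsum_coe]
  · refine le_trans (le_of_eq ?_) (ENNReal.ofReal_le_ofReal (hβ e₁ e₂ hne))
    rw [ENNReal.ofReal_sum_of_nonneg fun _ _ => Real.sqrt_nonneg _]
    refine Finset.sum_congr rfl fun q' _ => ?_
    rw [Real.sqrt_eq_rpow, ← ENNReal.toReal_mul, ENNReal.toReal_rpow, ENNReal.ofReal_toReal]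
    exact ENNReal.rpow_ne_top_of_nonneg (by norm_num)
      (ENNReal.mul_ne_top (PMF.apply_ne_top _ _) (PMF.apply_ne_top _ _))

/-! ### Estimates up to an additive error -/

/-- The numbers `x` and `y` differ by at most `d`. -/
def Near (d x y : ℝ≥0∞) : Prop := x ≤ y + d ∧ y ≤ x + d

theorem Near.mono {d d' x y : ℝ≥0∞} (h : Near d x y) (hd : d ≤ d') : Near d' x y :=
  ⟨h.1.trans (by gcongr), h.2.trans (by gcongr)⟩

theorem Near.trans {d d' x y z : ℝ≥0∞} (h : Near d x y) (h' : Near d' y z) :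
    Near (d + d') x z := by
  refine ⟨h.1.trans ?_, h'.2.trans ?_⟩
  · rw [add_comm d, ← add_assoc]
    exact add_le_add_left h'.1 d
  · rw [← add_assoc]
    exact add_le_add_left h.2 d'

theorem Near.of_le_one {d x y : ℝ≥0∞} (hd : 1 ≤ d) (hx : x ≤ 1) (hy : y ≤ 1) : Near d x y :=
  ⟨hx.trans (hd.trans le_add_self), hy.trans (hd.trans le_add_self)⟩

theorem Near.abs_toReal_sub_le {d x y : ℝ} {X : ℝ≥0∞} (hd : 0 ≤ d) (hy : 0 ≤ y)
    (hX : X.toReal = x) (hXt : X ≠ ∞) (h : Near (ENNReal.ofReal d) X (ENNReal.ofReal y)) :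
    |x - y| ≤ d := by
  subst hX
  rw [← ENNReal.ofReal_toReal hXt] at h
  obtain ⟨h1, h2⟩ := h
  rw [← ENNReal.ofReal_add hy hd, ENNReal.ofReal_le_ofReal_iff (by positivity)] at h1
  rw [← ENNReal.ofReal_add ENNReal.toReal_nonneg hd,
    ENNReal.ofReal_le_ofReal_iff (by positivity)] at h2
  rw [abs_le]
  constructor <;> linarith

theorem near_truncBits {t : ℝ} (ht : 0 < t) (x : unitInterval) :
    Near (ENNReal.ofReal t) (ENNReal.ofReal x)
      (ENNReal.ofReal (truncBits ⌈|Real.logb 2 t|⌉₊ x)) := by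
  set k := ⌈|Real.logb 2 t|⌉₊ with hk
  have h2 : (0 : ℝ) < 2 ^ k := by positivity
  -- Here k ≥ |log t| ≥ −log t; truncation loses less than one unit of the last digit.
  have hkt : 1 / 2 ^ k ≤ t := by
    rw [div_le_iff₀ h2, ← div_le_iff₀' ht, ← Real.logb_le_logb (b := 2) (by norm_num) (by positivity)
      h2, Real.logb_pow, Real.logb_div one_ne_zero ht.ne', Real.logb_one, zero_sub,
      Real.logb_self_eq_one (by norm_num), mul_one]
    exact (neg_le_abs _).trans (Nat.le_ceil _)
  have hv : (truncBits k x : ℝ) = ⌊(2 : ℝ) ^ k * x⌋₊ / 2 ^ k := rfl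
  constructor
  · rw [← ENNReal.ofReal_add (truncBits k x).2.1 ht.le]
    refine ENNReal.ofReal_le_ofReal (le_trans ?_ (add_le_add_right hkt _))
    rw [hv, ← add_div, le_div_iff₀ h2, mul_comm]
    exact (Nat.lt_floor_add_one _).le
  · refine le_trans (ENNReal.ofReal_le_ofReal ?_) le_self_add
    rw [hv, div_le_iff₀ h2, mul_comm (x : ℝ)]
    exact Nat.floor_le (mul_nonneg h2.le x.2.1)

theorem ofReal_unitInterval_le_one (x : unitInterval) : ENNReal.ofReal x ≤ 1 :=
  ENNReal.ofReal_le_one.2 x.2.2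

/-! ### Truncated beliefs and the unfolded algorithm -/

section Algorithm

variable {Q A E : Type*} [Fintype Q] [Fintype A] [Fintype E]
  [MeasurableSpace Q] [MeasurableSingletonClass Q] [MeasurableSpace A] [MeasurableSingletonClass A]
  (Γ : MEMDP Q A E)

theorem MEMDP.payoff_map (b : PMF E) (f : E → E) (σ : Strat Q A) (q : Q) (W : Set (ℕ → Q)) :
    Γ.payoff σ (b.map f) q W = ∑ e, b e * (Γ.env (f e)).prob σ q W := by
  classical
  simp only [payoff, PMF.map_apply, tsum_fintype, Finset.sum_mul, ite_mul, zero_mul]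
  rw [Finset.sum_comm]
  simp

/-- For each fixed strategy only the term of the removed environment changes. Its weight is minimal
on the support, hence at most `d`, and probabilities lie in [0,1]. -/
theorem MEMDP.near_priorValue_truncate {b : PMF E} {d : ℝ≥0∞} (h : b.support.ncard ≠ 1)
    (hd : ∃ e ∈ b.support, b e ≤ d) (q : Q) (W : Set (ℕ → Q)) :
    Near d (Γ.priorValue b q W) (Γ.priorValue (truncate b) q W) := by
  classical
  have hx := exists_isTruncationPair b h
  obtain ⟨-, -, -, hmin⟩ := hx.choose_spec
  obtain ⟨e₀, he₀, hed⟩ := hd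
  have hle : b hx.choose.1 ≤ d := (hmin e₀ he₀).trans hed
  set f : E → E := fun e => if e = hx.choose.1 then hx.choose.2 else e with hf
  have htr : truncate b = b.map f := by rw [truncate, dif_pos hx]
  have hsum : ∀ u v : E → ℝ≥0∞, (∀ e, u e ≤ 1) → (∀ e ≠ hx.choose.1, u e = v e) →
      ∑ e, b e * u e ≤ ∑ e, b e * v e + d := by
    intro u v hu huv
    calc ∑ e, b e * u e ≤ ∑ e, (b e * v e + if e = hx.choose.1 then b e else 0) := by
          refine Finset.sum_le_sum fun e _ => ?_
          split_ifs with he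
          · exact (mul_le_of_le_one_right' (hu e)).trans le_add_self
          · rw [huv e he, add_zero]
      _ ≤ _ := by
          rw [Finset.sum_add_distrib]
          simpa using add_le_add_right hle _
  constructor
  · refine iSup_le fun σ => ?_
    refine le_trans ?_ (add_le_add_left (Γ.payoff_le_priorValue (truncate b) σ q W) d)
    rw [htr, MEMDP.payoff_map]
    exact hsum _ _ (fun e => MDP.prob_le_one _ _ _ _) fun e he => by simp [hf, he]
  · refine iSup_le fun σ => ?_
    refine le_trans ?_ (add_le_add_left (Γ.payoff_le_priorValue b σ q W) d)
    change Γ.payoff σ (truncate b) q W ≤ _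
    rw [htr, MEMDP.payoff_map]
    exact hsum _ _ (fun e => MDP.prob_le_one _ _ _ _) fun e he => by simp [hf, he]

theorem ofReal_mdpParity {Q A : Type*} [Fintype Q] [Fintype A] [MeasurableSpace Q]
    [MeasurableSingletonClass Q] [MeasurableSpace A] [MeasurableSingletonClass A]
    (G : MDP Q A) (c : Q → ℕ) (q : Q) :
    ENNReal.ofReal (mdpParity G c q) = G.value q (parityObjective c) :=
  ENNReal.ofReal_toReal (ne_top_of_le_ne_top ENNReal.one_ne_top (G.value_le_one _ _))

theorem MEMDP.priorValue_of_ncard_eq_one {b : PMF E} (h : b.support.ncard = 1) (q : Q)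
    (W : Set (ℕ → Q)) :
    Γ.priorValue b q W = (Γ.env b.support_nonempty.some).value q W := by
  classical
  obtain ⟨e, he⟩ := ncard_eq_one.1 h
  have hsome : b.support_nonempty.some = e :=
    eq_of_mem_singleton (he.subset b.support_nonempty.some_mem)
  have hb : ∀ e', e' ≠ e → b e' = 0 := fun e' hne =>
    (PMF.apply_eq_zero_iff b e').2 (by rw [he]; exact hne)
  have h1 : b e = 1 := by
    rw [← b.sum_coe, Finset.sum_eq_single e (fun e' _ hne => hb e' hne) (by simp)]
  rw [hsome, MEMDP.priorValue, MDP.value]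
  refine iSup_congr fun σ => ?_
  rw [Finset.sum_eq_single e (fun e' _ hne => by rw [hb e' hne, zero_mul]) (by simp), h1, one_mul]

variable (c : Q → ℕ) (γ : ℝ)

open scoped Classical in
/-- The truncated values that the algorithm computes for the states after a distinguishing pair. -/
noncomputable def priorParityEstimate (b : PMF E) (n : ℕ) (q : Q) (a : A) (q' : Q) :
    unitInterval :=
  if (q, a) ∈ Γ.dstg b.support ∧ q' ∈ (Γ.next b q a).support then
    truncBits
      ⌈|Real.logb 2 (γ / (3 * Fintype.card E) * (1 / Γ.bound (γ / (3 * Fintype.card E))))|⌉₊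
      (priorParity Γ c γ (Γ.update b q a q')
        (if (Γ.update b q a q').support ⊂ b.support then
          Γ.bound (γ / (3 * Fintype.card E)) else n - 1) q')
  else 0

theorem priorParity_of_ncard_eq_one {b : PMF E} (h : b.support.ncard = 1) (n : ℕ) :
    priorParity Γ c γ b n = mdpParity (Γ.env b.support_nonempty.some) c := by
  rw [priorParity, if_pos h]

theorem priorParity_eq_truncate {b : PMF E} (h : b.support.ncard ≠ 1) {n : ℕ}
    (hn : n = 0 ∨ ∃ e ∈ b.support, (b e).toReal ≤ γ / (3 * Fintype.card E)) :
    priorParity Γ c γ b n =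
      priorParity Γ c γ (truncate b) (Γ.bound (γ / (3 * Fintype.card E))) := by
  rw [priorParity, if_neg h, if_pos hn]

theorem priorParity_eq_mdpParity {b : PMF E} (h : b.support.ncard ≠ 1) {n : ℕ}
    (hn : ¬(n = 0 ∨ ∃ e ∈ b.support, (b e).toReal ≤ γ / (3 * Fintype.card E))) (q : Q) :
    priorParity Γ c γ b n q =
      mdpParity (mdpFromMEMDP Γ b (priorParityEstimate Γ c γ b n)) (sinkLabel c) (Sum.inl q) := by
  rw [priorParity, if_neg h, if_neg hn]
  rfl

end Algorithm

/-! ### The error of the algorithm -/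

section Error

variable {Q A E : Type*} [Fintype Q] [Fintype A] [Nonempty A] [Fintype E]
  [MeasurableSpace Q] [MeasurableSingletonClass Q] [MeasurableSpace A] [MeasurableSingletonClass A]
  (Γ : MEMDP Q A E) (c : Q → ℕ) (γ : ℝ)

open scoped Classical in
/-- The support of a belief as a finset. -/
noncomputable def PMF.suppFinset (b : PMF E) : Finset E := {e | e ∈ b.support}

theorem PMF.mem_suppFinset {b : PMF E} {e : E} : e ∈ b.suppFinset ↔ e ∈ b.support := by
  simp [suppFinset]

theorem PMF.suppFinset_nonempty (b : PMF E) : b.suppFinset.Nonempty :=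
  ⟨_, PMF.mem_suppFinset.2 b.support_nonempty.some_mem⟩

theorem PMF.coe_suppFinset (b : PMF E) : (b.suppFinset : Set E) = b.support := by
  ext e
  exact PMF.mem_suppFinset

/-- A bound on the probability that `n` further distinguishing pairs leave all environments in the
support of the belief with probability above `K`. -/
noncomputable def undecidedBound (β : ℝ) (K : ℝ≥0∞) (n : ℕ) (b : PMF E) : ℝ≥0∞ :=
  (ENNReal.ofReal β ^ (2 / b.suppFinset.card : ℝ)) ^ n * geoMean b.suppFinset b / K

/-- Makes the error claim trivial when the counter runs out on an undecided belief. -/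
theorem one_le_undecidedBound_zero (β : ℝ) {K : ℝ≥0∞} (hK0 : K ≠ 0) (hK : K ≠ ∞) {b : PMF E}
    (hb : ∀ e ∈ b.support, K ≤ b e) : 1 ≤ undecidedBound β K 0 b := by
  rw [undecidedBound, pow_zero, one_mul, ← ENNReal.div_self hK0 hK]
  gcongr
  exact le_geoMean b.suppFinset_nonempty b fun e he => hb e (PMF.mem_suppFinset.1 he)

theorem undecidedBound_le {β : ℝ} (hβ0 : 0 ≤ β) (hβ1 : β ≤ 1) {κ : ℝ} (hκ : 0 < κ) {N : ℕ}
    (hN : β ^ N ≤ κ) (b : PMF E) :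
    undecidedBound β (ENNReal.ofReal κ) (Fintype.card E * N) b ≤ ENNReal.ofReal κ := by
  have hs : (0 : ℝ) < b.suppFinset.card := by exact_mod_cast b.suppFinset_nonempty.card_pos
  have hK0 : ENNReal.ofReal κ ≠ 0 := (ENNReal.ofReal_pos.2 hκ).ne'
  -- The factor |E| in the bound absorbs the root of order s ≤ |E|, which leaves β^(2N) ≤ κ². One
  -- factor κ pays for the division by `K`.
  have h1 : (ENNReal.ofReal β ^ (2 / b.suppFinset.card : ℝ)) ^ (Fintype.card E * N) ≤
      ENNReal.ofReal κ * ENNReal.ofReal κ := by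
    rw [← ENNReal.rpow_natCast, ← ENNReal.rpow_mul]
    calc _ ≤ ENNReal.ofReal β ^ ((N + N : ℕ) : ℝ) := by
          refine ENNReal.rpow_le_rpow_of_exponent_ge (ENNReal.ofReal_le_one.2 hβ1) ?_
          rw [div_mul_eq_mul_div, le_div_iff₀ hs]
          have : (b.suppFinset.card : ℝ) ≤ Fintype.card E := by
            exact_mod_cast Finset.card_le_univ _
          have := mul_le_mul_of_nonneg_right this (Nat.cast_nonneg (α := ℝ) N)
          push_cast
          linarith
      _ = ENNReal.ofReal (β ^ N) * ENNReal.ofReal (β ^ N) := by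
          rw [ENNReal.rpow_natCast, pow_add, ENNReal.ofReal_pow hβ0]
      _ ≤ _ := by gcongr
  rw [undecidedBound]
  refine ENNReal.div_le_of_le_mul ?_
  exact (mul_le_of_le_one_right' (geoMean_le_one _ _)).trans h1

/-- The error estimate for one level of the algorithm, that is for a fixed number of environments in
the support of the belief. -/
theorem near_priorParity_of_level {β κ : ℝ} (hκ : κ = γ / (3 * Fintype.card E)) (hκ0 : 0 < κ)
    (hm : 0 < Γ.bound κ)
    (hβ : ∀ e e' q a, (Γ.env e).δ q a ≠ (Γ.env e').δ q a →
      ∑ q', √(((Γ.env e).δ q a q').toReal * ((Γ.env e').δ q a q').toReal) ≤ β)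
    {s : ℕ} (hs : s ≠ 1) {D : ℝ≥0∞}
    (ih : ∀ b : PMF E, b.support.ncard < s → ∀ q,
      Near D (Γ.priorValue b q (parityObjective c))
        (ENNReal.ofReal (priorParity Γ c γ b (Γ.bound κ) q))) (n : ℕ) :
    ∀ b : PMF E, b.support.ncard = s → ∀ q,
      Near (D + ENNReal.ofReal κ + n * ENNReal.ofReal (κ * (1 / Γ.bound κ)) +
          undecidedBound β (ENNReal.ofReal κ) n b)
        (Γ.priorValue b q (parityObjective c))
        (ENNReal.ofReal (priorParity Γ c γ b n q)) := by
  classical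
  have hK0 : ENNReal.ofReal κ ≠ 0 := (ENNReal.ofReal_pos.2 hκ0).ne'
  have ht0 : 0 < κ * (1 / Γ.bound κ) := by
    have : (0 : ℝ) < Γ.bound κ := by exact_mod_cast hm
    positivity
  have hsmall : ∀ b : PMF E, ∀ e, (b e).toReal ≤ κ ↔ b e ≤ ENNReal.ofReal κ := fun b e =>
    (ENNReal.le_ofReal_iff_toReal_le (b.apply_ne_top e) hκ0.le).symm
  have htrunc : ∀ b : PMF E, b.support.ncard = s → (∃ e ∈ b.support, (b e).toReal ≤ κ) → ∀ n q,
      Near (D + ENNReal.ofReal κ) (Γ.priorValue b q (parityObjective c))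
        (ENNReal.ofReal (priorParity Γ c γ b n q)) := by
    intro b hb hex n q
    have hne : b.support.ncard ≠ 1 := hb ▸ hs
    rw [priorParity_eq_truncate Γ c γ hne (Or.inr (hκ ▸ hex)), add_comm, ← hκ]
    refine (Γ.near_priorValue_truncate hne ?_ q _).trans (ih _ ?_ q)
    · obtain ⟨e, he, hle⟩ := hex
      exact ⟨e, he, (hsmall b e).1 hle⟩
    · rw [← hb]
      exact ncard_lt_ncard (support_truncate_ssubset b hne)
  induction n with
  | zero =>
    intro b hb q
    by_cases hex : ∃ e ∈ b.support, (b e).toReal ≤ κ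
    · exact (htrunc b hb hex 0 q).mono (by rw [add_assoc]; exact le_self_add)
    · push Not at hex
      refine Near.of_le_one ?_ (Γ.priorValue_le_one _ _ _) (ofReal_unitInterval_le_one _)
      refine (one_le_undecidedBound_zero β hK0 ENNReal.ofReal_ne_top fun e he => ?_).trans
        le_add_self
      exact (not_le.1 fun h => not_le.2 (hex e he) ((hsmall b e).2 h)).le
  | succ n ihn =>
    intro b hb q
    by_cases hex : ∃ e ∈ b.support, (b e).toReal ≤ κ
    · exact (htrunc b hb hex _ q).mono (by rw [add_assoc]; exact le_self_add)
    have hne : b.support.ncard ≠ 1 := hb ▸ hs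
    have hcond : ¬(n + 1 = 0 ∨ ∃ e ∈ b.support, (b e).toReal ≤ γ / (3 * Fintype.card E)) := by
      rw [← hκ]
      rintro (h | h)
      · omega
      · exact hex h
    rw [priorParity_eq_mdpParity Γ c γ hne hcond, ofReal_mdpParity]
    set T := ENNReal.ofReal (κ * (1 / Γ.bound κ)) with hT
    set v := priorParityEstimate Γ c γ b (n + 1) with hv
    -- One more T than in the induction hypothesis, for truncating this value. The potential uses
    -- the old support: it equals the true one if the support is unchanged, and any nonnegative term
    -- will do if it shrinks.
    set err : Q × A → Q → ℝ≥0∞ := fun x q' => D + ENNReal.ofReal κ + (n + 1 : ℕ) * T +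
      (ENNReal.ofReal β ^ (2 / b.suppFinset.card : ℝ)) ^ n *
        geoMean b.suppFinset (Γ.update b x.1 x.2 q') / ENNReal.ofReal κ with herr
    have hnear : ∀ x ∈ Γ.dstg b.support, ∀ q' ∈ (Γ.next b x.1 x.2).support,
        Near (err x q') (Γ.priorValue (Γ.update b x.1 x.2 q') q' (parityObjective c))
          (ENNReal.ofReal (v x.1 x.2 q')) := by
      intro x hx q' hq'
      have hvx : v x.1 x.2 q' = truncBits ⌈|Real.logb 2 (κ * (1 / Γ.bound κ))|⌉₊
          (priorParity Γ c γ (Γ.update b x.1 x.2 q')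
            (if (Γ.update b x.1 x.2 q').support ⊂ b.support then Γ.bound κ else n) q') := by
        rw [hv, priorParityEstimate, if_pos ⟨hx, hq'⟩, ← hκ]
        rfl
      rw [hvx]
      -- A smaller support restarts the counter at the full bound, so the hypothesis for lower
      -- levels applies and costs D + T.
      by_cases hsub : (Γ.update b x.1 x.2 q').support ⊂ b.support
      · rw [if_pos hsub]
        refine ((ih _ (hb ▸ ncard_lt_ncard hsub) q').trans (near_truncBits ht0 _)).mono ?_
        simp only [herr, ← hT, Nat.cast_succ, add_mul, one_mul]
        refine le_trans ?_ le_self_add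
        gcongr
        · exact le_self_add
        · exact le_add_self
      · rw [if_neg hsub]
        have heq := ((Γ.support_update_subset b x.1 x.2 q').eq_or_ssubset).resolve_right hsub
        have hfin : (Γ.update b x.1 x.2 q').suppFinset = b.suppFinset := by
          ext e
          rw [PMF.mem_suppFinset, PMF.mem_suppFinset, heq]
        refine ((ihn _ (by rw [heq, hb]) q').trans (near_truncBits ht0 _)).mono ?_
        simp only [herr, undecidedBound, hfin, ← hT, Nat.cast_succ, add_mul, one_mul]
        refine le_of_eq ?_
        ring
    have hsum : ∀ x ∈ Γ.dstg b.support, ∑ q', Γ.next b x.1 x.2 q' * err x q' ≤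
        D + ENNReal.ofReal κ + (n + 1 : ℕ) * T +
          undecidedBound β (ENNReal.ofReal κ) (n + 1) b := by
      intro x hx
      simp only [herr, mul_add, Finset.sum_add_distrib, ← Finset.sum_mul, PMF.sum_coe, one_mul]
      gcongr
      have h1 := Γ.sum_next_mul_geoMean_le b (S := b.suppFinset) (q := x.1) (a := x.2)
        (by rwa [PMF.coe_suppFinset]) (fun e e' => hβ e e' x.1 x.2)
        (fun q' e => Γ.next_mul_update_apply b x.1 x.2 q' e)
      calc _ = (ENNReal.ofReal β ^ (2 / b.suppFinset.card : ℝ)) ^ n * (∑ q', Γ.next b x.1 x.2 q' *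
            geoMean b.suppFinset (Γ.update b x.1 x.2 q')) / ENNReal.ofReal κ := by
            simp only [div_eq_mul_inv, Finset.mul_sum, Finset.sum_mul]
            exact Finset.sum_congr rfl fun q' _ => by ring
        _ ≤ (ENNReal.ofReal β ^ (2 / b.suppFinset.card : ℝ)) ^ n *
            (ENNReal.ofReal β ^ (2 / b.suppFinset.card : ℝ) * geoMean b.suppFinset b) /
              ENNReal.ofReal κ := by gcongr
        _ = _ := by rw [undecidedBound, pow_succ, mul_assoc]
    have hterm : ∀ (x : Q × A) (f g : Q → ℝ≥0∞),
        (∀ q' ∈ (Γ.next b x.1 x.2).support, f q' ≤ g q' + err x q') →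
        ∑ q', Γ.next b x.1 x.2 q' * f q' ≤ ∑ q', Γ.next b x.1 x.2 q' * g q' +
          ∑ q', Γ.next b x.1 x.2 q' * err x q' := by
      intro x f g hfg
      rw [← Finset.sum_add_distrib]
      refine Finset.sum_le_sum fun q' _ => ?_
      rw [← mul_add]
      by_cases hq' : q' ∈ (Γ.next b x.1 x.2).support
      · exact mul_le_mul_right (hfg q' hq') _
      -- Off the support of the next state the estimate is the default 0, but it has weight zero.
      · rw [(PMF.apply_eq_zero_iff _ _).2 hq', zero_mul]
        exact zero_le
    constructor
    · refine Γ.priorValue_le_value_add b v c q _ fun x hx => ?_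
      rw [MEMDP.winProb_eq]
      exact (hterm x _ _ fun q' hq' => (hnear x hx q' hq').1).trans (by gcongr; exact hsum x hx)
    · refine Γ.value_le_priorValue_add b v c q _ fun x hx => ?_
      rw [MEMDP.winProb_eq]
      exact (hterm x _ _ fun q' hq' => (hnear x hx q' hq').2).trans (by gcongr; exact hsum x hx)

/-- A level costs κ for truncating the belief, κ for m roundings of size κ/m, and κ for undecided
beliefs. A one-point support costs nothing, which explains the −1. -/
theorem near_priorParity [Nonempty Q] {κ : ℝ} (hκ : κ = γ / (3 * Fintype.card E)) (hκ0 : 0 < κ)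
    (b : PMF E) (q : Q) :
    Near ((b.support.ncard - 1 : ℕ) * (3 * ENNReal.ofReal κ))
      (Γ.priorValue b q (parityObjective c))
      (ENNReal.ofReal (priorParity Γ c γ b (Γ.bound κ) q)) := by
  have : Nonempty E := ⟨b.support_nonempty.some⟩
  obtain ⟨β, hβ0, hβ1, hN, hβ⟩ := Γ.exists_affinity_bound hκ0
  have hm : 0 < Γ.bound κ :=
    Nat.mul_pos Fintype.card_pos (Nat.add_pos_left (Γ.one_le_n₁ κ) _)
  induction hs : b.support.ncard using Nat.strong_induction_on generalizing b q with
  | _ s ih =>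
    by_cases h1 : s = 1
    · have hb : b.support.ncard = 1 := hs.trans h1
      rw [priorParity_of_ncard_eq_one Γ c γ hb, ofReal_mdpParity,
        Γ.priorValue_of_ncard_eq_one hb]
      exact ⟨le_self_add, le_self_add⟩
    have hs2 : 2 ≤ s := by
      have : 0 < b.support.ncard := (ncard_pos).2 b.support_nonempty
      omega
    refine (near_priorParity_of_level Γ c γ hκ hκ0 hm hβ h1
      -- Supports below size s ≥ 2 have at most s − 1 elements, hence cost at most s − 2 levels.
      (D := (s - 2 : ℕ) * (3 * ENNReal.ofReal κ)) (fun b' hb' q' => ?_) (Γ.bound κ) b hs q).mono ?_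
    · exact (ih _ hb' b' q' rfl).mono (mul_le_mul_left (Nat.cast_le.2 (by omega)) _)
    · have hT : (Γ.bound κ : ℝ≥0∞) * ENNReal.ofReal (κ * (1 / Γ.bound κ)) = ENNReal.ofReal κ := by
        have : (Γ.bound κ : ℝ) ≠ 0 := by exact_mod_cast hm.ne'
        rw [← ENNReal.ofReal_natCast, ← ENNReal.ofReal_mul (by positivity)]
        congr 1
        field_simp
      have hU : undecidedBound β (ENNReal.ofReal κ) (Γ.bound κ) b ≤ ENNReal.ofReal κ :=
        undecidedBound_le hβ0 hβ1 hκ0 hN b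
      rw [hT]
      obtain ⟨k, rfl⟩ := Nat.exists_eq_add_of_le' hs2
      have e1 : k + 2 - 1 = k + 1 := rfl
      rw [e1, Nat.add_sub_cancel]
      refine (add_le_add_right hU _).trans_eq ?_
      push_cast
      ring

end Error

/-! ### The total error -/

theorem mainTheorem2 {Q A E : Type*} [Fintype Q] [Nonempty Q] [Fintype A] [Nonempty A] [Fintype E]
    [MeasurableSpace Q] [MeasurableSingletonClass Q]
    [MeasurableSpace A] [MeasurableSingletonClass A]
    (Γ : MEMDP Q A E) (c : Q → ℕ) (b : PMF E) (ε : ℝ) (hε : 0 < ε) (q : Q) :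
    |(Γ.priorValue b q (parityObjective c)).toReal -
      (priorParity Γ c ε b (Γ.bound (ε / (3 * Fintype.card E))) q : ℝ)| ≤ ε := by
  have : Nonempty E := ⟨b.support_nonempty.some⟩
  have hE : (0 : ℝ) < Fintype.card E := by exact_mod_cast Fintype.card_pos
  have hκ0 : 0 < ε / (3 * Fintype.card E) := by positivity
  refine Near.abs_toReal_sub_le hε.le (priorParity Γ c ε b _ q).2.1 rfl
    (ne_top_of_le_ne_top ENNReal.one_ne_top (Γ.priorValue_le_one _ _ _))
    ((near_priorParity Γ c ε rfl hκ0 b q).mono ?_)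
  calc ((b.support.ncard - 1 : ℕ) : ℝ≥0∞) * (3 * ENNReal.ofReal (ε / (3 * Fintype.card E)))
      ≤ (Fintype.card E : ℕ) * (3 * ENNReal.ofReal (ε / (3 * Fintype.card E))) := by
        gcongr
        refine (Nat.sub_le _ _).trans ?_
        rw [← Nat.card_eq_fintype_card]
        exact ncard_le_card _
    _ = ENNReal.ofReal ε := by
        rw [← mul_assoc, ← ENNReal.ofReal_natCast, show (3 : ℝ≥0∞) = ENNReal.ofReal 3 by simp,
          ← ENNReal.ofReal_mul (by positivity), ← ENNReal.ofReal_mul (by positivity)]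
        congr 1
        field_simp
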